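/- **Setting.** Let $(X_i,Y_i)$, $i=1,2,\dots$, be i.i.d. with values in $\mathbb R^p\times\mathbb R$, let $\alpha\in(0,1]$ and $C,K>0$. For every $x$ the conditional law of $Y$ given $X=x$ has a density $f(\cdot\mid x)$ that vanishes outside $[-C,C]$, satisfies $1/K<f(y\mid x)<K/2$ on $[-C,C]$, and is unimodal: for some $y_0\in[-C,C]$ it is nondecreasing on $(-\infty,y_0]$ and nonincreasing on $[y_0,\infty)$. Write $F(\cdot\mid x)$ for its distribution function. An oracle interval at $x$ is any $[l,u]$, $l\le u$, of minimal length among those with $\int_l^u f(y\mid x)\,dy\ge 1-\alpha$; its length is written $|C^{\rm oracle}_\alpha(x)|$. **Estimator.** Let $0<\eta_n\le 1$, $\eta_n\to0$, $m_n=\lfloor\eta_n^{-1}\rfloor$ and $T_n=n$. Divide $[-C,C]$ into the $m_n$ bins $[b_{j-1},b_j)$ of equal width, $b_j=-C+2Cj/m_n$. From the training sample $\mathcal D^{\rm train}=\{(X_i,Y_i)\}_{i\le n}$ a black-box algorithm computes, for each $x$, a probability vector $\hat\pi(x)=(\hat\pi_1(x),\dots,\hat\pi_{m_n}(x))$ (measurable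 in sample and $x$) that is unimodal in $j$ and satisfies $\hat\pi_j(x)\le K\eta_n$. With $\hat F(b_j\mid x)=\sum_{i\le j}\hat\pi_i(x)$ it is consistent: for all $n\ge1$ and $1\le j\le m_n$, with $X$ a new feature vector, $$\mathbb P\Big[\mathbb E\big[(\hat F(b_j\mid X)-F(b_j\mid X))^2\mid\mathcal D^{\rm train}\big]\le\eta_n^2\Big]\ge1-\eta_n^2 .$$ **Prediction interval.** Let $\tau_t=t/n$, and let $\bar t_n\in\{0,\dots,n\}$ satisfy $|\tau_{\bar t_n}-(1-\alpha)|\le1/n$. For a histogram $\pi$, sets $S^-,S^+$ of bins and a level $\tau$, let $\mathcal S(\pi,S^-,S^+,\tau)$ be an interval of bins $[l,u]$, $1\le l\le u\le m_n$, with $S^-\subseteq[l,u]\subseteq S^+$ and $\sum_{j=l}^u\pi_j\ge\tau$, of least $u-l$ and, among those, of least mass; remaining ties are resolved by an arbitrary fixed rule. Put $S_{\bar t_n}=\mathcal S(\hat\pi(x),\emptyset,\{1,\dots,m_n\},\tau_{\bar t_n})$, then recursively $S_t=\mathcal S(\hat\pi(x),S_{t-1},\{1,\dots,m_n\},\tau_t)$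 for $t>\bar t_n$ and $S_t=\mathcal S(\hat\pi(x),\emptyset,S_{t+1},\tau_t)$ for $t<\bar t_n$. Write $S_t(x)$ also for the subset $[b_{l-1},b_u)$ of the line covered by these bins. For $n<i\le2n$ let $E_i=\min\{t\le n: Y_i\in S_t(X_i)\}$ ($E_i=n$ if there is no such $t$), and let $\hat t$ be the $\lceil(1-\alpha)(n+1)\rceil$-th smallest of these $n$ scores ($\hat t=n$ if that rank exceeds $n$, $\hat t=0$ if it is $0$). The split-conformal interval without randomization is $\hat C_n=S_{\hat t}(X_{2n+1})$, with length $|\hat C_n|=b_u-b_{l-1}$. **Theorem.** Let $$\epsilon_n=\tfrac2n+5\eta_n^{1/3}+(1+2K)\eta_n+2\sqrt{\tfrac{\log n}{n}},\qquad \gamma_n=4C\eta_n+K(\epsilon_n+2\eta_n^{1/3}),\qquad \xi_n=\zeta_n=\eta_n^{1/3}+\eta_n+2n^{-2}.$$ All these sequences tend to $0$, and for every $n\ge1$: (i) $\mathbb P\big[\,|\hat C_n|\le|C^{\rm oracle}_\alpha(X_{2n+1})|+\gamma_n\,\big]\ge1-\xi_n$; (ii) $\mathbb P\big[\,\mathbb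 P[Y_{2n+1}\in\hat C_n\mid\mathcal G]\ge1-\alpha-\epsilon_n\,\big]\ge1-\zeta_n$, both for $\mathcal G=\sigma(X_{2n+1})$ and for $\mathcal G=\sigma\big((X_i,Y_i)_{i\le2n},X_{2n+1}\big)$. -/

import Mathlib

open MeasureTheory ProbabilityTheory Filter Topology

noncomputable section

namespace CHR

/-! Histograms are functions `π : ℕ → ℝ` of which only the values at the bins `1, …, m` matter.
A contiguous set of bins `{l, …, u}` is the pair `(l, u)`. -/

/-- The endpoint `b_j` of the partition of `[-C, C]` into `m` bins of equal width. -/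
def edge (C : ℝ) (m j : ℕ) : ℝ := -C + 2 * C * j / m

/-- The bins of the interval `I = (l, u)`. -/
def bins (I : ℕ × ℕ) : Finset ℕ := Finset.Icc I.1 I.2

/-- The mass that the histogram `π` gives to the bins `l, …, u`. -/
def mass (π : ℕ → ℝ) (I : ℕ × ℕ) : ℝ := ∑ j ∈ bins I, π j

/-- The subset `[b_{l-1}, b_u)` of the real line covered by the bins `l, …, u`. -/
def toSet (C : ℝ) (m : ℕ) (I : ℕ × ℕ) : Set ℝ := Set.Ico (edge C m (I.1 - 1)) (edge C m I.2)

/-- The length `b_u - b_{l-1}` of the interval covered by the bins `l, …, u`. -/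
def len (C : ℝ) (m : ℕ) (I : ℕ × ℕ) : ℝ := edge C m I.2 - edge C m (I.1 - 1)

open Classical in
/-- The intervals `1 ≤ l ≤ u ≤ m` of mass at least `τ` lying between `Slo` and `Shi`. -/
def feasible (m : ℕ) (π : ℕ → ℝ) (Slo Shi : Finset ℕ) (τ : ℝ) : Finset (ℕ × ℕ) :=
  (Finset.Icc 1 m ×ˢ Finset.Icc 1 m).filter fun I =>
    I.1 ≤ I.2 ∧ τ ≤ mass π I ∧ Slo ⊆ bins I ∧ bins I ⊆ Shi

open Classical in
/-- The feasible intervals with the least `u - l` and, among these, with the least mass. -/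
def solutions (m : ℕ) (π : ℕ → ℝ) (Slo Shi : Finset ℕ) (τ : ℝ) : Finset (ℕ × ℕ) :=
  (feasible m π Slo Shi τ).filter fun I => ∀ J ∈ feasible m π Slo Shi τ,
    I.2 - I.1 < J.2 - J.1 ∨ (I.2 - I.1 = J.2 - J.1 ∧ mass π I ≤ mass π J)

/-- The levels `τ_t = t / T`. -/
def level (T t : ℕ) : ℝ := (t : ℝ) / T

/-- `up … k` is `S_{t₀ + k}`: the starting interval `S_{t₀}` has no nesting constraint, and each
following one has to contain its predecessor. The rule `ρ` picks one of the solutions. -/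
def up (ρ : Finset (ℕ × ℕ) → ℕ × ℕ) (m T t₀ : ℕ) (π : ℕ → ℝ) : ℕ → ℕ × ℕ
  | 0 => ρ (solutions m π ∅ (Finset.Icc 1 m) (level T t₀))
  | k + 1 => ρ (solutions m π (bins (up ρ m T t₀ π k)) (Finset.Icc 1 m) (level T (t₀ + (k + 1))))

/-- `down … k` is `S_{t₀ - k}` for `k ≤ t₀`: going down from `t₀`, each interval has to lie in the
one found before it. -/
def down (ρ : Finset (ℕ × ℕ) → ℕ × ℕ) (m T t₀ : ℕ) (π : ℕ → ℝ) : ℕ → ℕ × ℕ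
  | 0 => ρ (solutions m π ∅ (Finset.Icc 1 m) (level T t₀))
  | k + 1 => ρ (solutions m π ∅ (bins (down ρ m T t₀ π k)) (level T (t₀ - (k + 1))))

/-- The nested sequence `S_t`, `t = 0, …, T`, without randomization, with starting index `t₀`. -/
def nested (ρ : Finset (ℕ × ℕ) → ℕ × ℕ) (m T t₀ : ℕ) (π : ℕ → ℝ) (t : ℕ) : ℕ × ℕ :=
  if t₀ ≤ t then up ρ m T t₀ π (t - t₀) else down ρ m T t₀ π (t₀ - t)

/-- The conformity score `min {t ∈ {0, …, T} : y ∈ S_t}`; it is `T` if no `S_t` contains `y`. -/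
def score (C : ℝ) (m T : ℕ) (S : ℕ → ℕ × ℕ) (y : ℝ) : ℕ :=
  sInf {t : ℕ | t = T ∨ (t < T ∧ y ∈ toSet C m (S t))}

open Classical in
/-- The `k`-th smallest of the scores `E_1, …, E_n ∈ {0, …, T}`: the least `t` such that at least
`k` scores are at most `t`. It is `T` if `k > n`, and `0` if `k = 0`. -/
def kthSmallest {n : ℕ} (T k : ℕ) (E : Fin n → ℕ) : ℕ :=
  if k ≤ n then sInf {t : ℕ | k ≤ (Finset.univ.filter fun i => E i ≤ t).card} else T

/-- The interval of bins that split-conformal histogram regression without randomization returns at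
the test point `x`, at level `1 - α`: `T` is the resolution of the scores, `t₀` the starting index,
`h` the fitted histogram (as a function of the features) and `cal` the calibration sample. -/
def predict {𝒳 : Type*} {n : ℕ} (C α : ℝ) (ρ : Finset (ℕ × ℕ) → ℕ × ℕ) (m T t₀ : ℕ)
    (h : 𝒳 → ℕ → ℝ) (cal : Fin n → 𝒳 × ℝ) (x : 𝒳) : ℕ × ℕ :=
  nested ρ m T t₀ (h x)
    (kthSmallest T ⌈(1 - α) * (n + 1)⌉₊
      fun i => score C m T (nested ρ m T t₀ (h (cal i).1)) (cal i).2)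

/-- `[l, u]` is a shortest interval to which the density `g` gives mass at least `τ`. -/
def IsOracleInterval (g : ℝ → ℝ) (τ : ℝ) (I : ℝ × ℝ) : Prop :=
  (I.1 ≤ I.2 ∧ τ ≤ ∫ y in I.1..I.2, g y) ∧
    ∀ l u : ℝ, l ≤ u → τ ≤ (∫ y in l..u, g y) → I.2 - I.1 ≤ u - l

/-- `f` is a conditional density of `Y` given `X`: `f (x, ·)` is a probability density for each `x`,
and the law of `(X, Y)` has density `f` with respect to the product of the law of `X` and Lebesgue
measure. -/
structure IsCondDensity {Ω 𝒳 : Type*} [MeasurableSpace Ω] [MeasurableSpace 𝒳] (μ : Measure Ω)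
    (X : Ω → 𝒳) (Y : Ω → ℝ) (f : 𝒳 → ℝ → ℝ) : Prop where
  measurable : Measurable (Function.uncurry f)
  nonneg : ∀ x y, 0 ≤ f x y
  lintegral_eq_one : ∀ x, ∫⁻ y, ENNReal.ofReal (f x y) = 1
  map_eq : μ.map (fun ω => (X ω, Y ω)) =
    ((μ.map X).prod volume).withDensity fun p => ENNReal.ofReal (f p.1 p.2)

/-- The distribution function of the density `g`. -/
def cdfOf (g : ℝ → ℝ) (y : ℝ) : ℝ := ∫ s in Set.Iic y, g s

/-- Unimodality of a density supported on `[-C, C]`. -/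
def IsUnimodal (C : ℝ) (g : ℝ → ℝ) : Prop :=
  ∃ y₀ ∈ Set.Icc (-C) C, MonotoneOn g (Set.Iic y₀) ∧ AntitoneOn g (Set.Ici y₀)

/-- `π` is a probability vector on the bins `1, …, m`. -/
def IsHistogram (m : ℕ) (π : ℕ → ℝ) : Prop :=
  (∀ j ∈ Finset.Icc 1 m, 0 ≤ π j) ∧ ∑ j ∈ Finset.Icc 1 m, π j = 1

/-- Unimodality of a histogram with `m` bins. -/
def IsUnimodalHistogram (m : ℕ) (π : ℕ → ℝ) : Prop :=
  ∃ j₀ ∈ Set.Icc 1 m, MonotoneOn π (Set.Icc 1 j₀) ∧ AntitoneOn π (Set.Icc j₀ m)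

/-! The sequences of the theorem. -/

/-- The number `m_n = ⌊1 / η_n⌋` of bins. -/
def numBins (η : ℕ → ℝ) (n : ℕ) : ℕ := ⌊(η n)⁻¹⌋₊

/-- `ε_n`, the loss of conditional coverage. -/
def epsSeq (K : ℝ) (η : ℕ → ℝ) (n : ℕ) : ℝ :=
  2 / n + 5 * η n ^ (1 / 3 : ℝ) + (1 + 2 * K) * η n + 2 * √(Real.log n / n)

/-- `γ_n`, the excess length. -/
def gammaSeq (C K : ℝ) (η : ℕ → ℝ) (n : ℕ) : ℝ :=
  4 * C * η n + K * (epsSeq K η n + 2 * η n ^ (1 / 3 : ℝ))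

/-- `ξ_n = δ_n + 2 n⁻²` with `δ_n = η_n^{1/3} + η_n`. -/
def xiSeq (η : ℕ → ℝ) (n : ℕ) : ℝ := (η n ^ (1 / 3 : ℝ) + η n) + 2 / (n : ℝ) ^ 2

/-- `ζ_n`. -/
def zetaSeq (η : ℕ → ℝ) (n : ℕ) : ℝ := η n ^ (1 / 3 : ℝ) + η n + 2 / (n : ℝ) ^ 2

/-! The observations `(X_i, Y_i)` are numbered from `0`: at stage `n` the training sample is
`i = 0, …, n - 1`, the calibration sample is `i = n, …, 2n - 1`, the test point is `i = 2n`. -/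

section Sample

variable {Ω 𝒳 : Type*} (X : ℕ → Ω → 𝒳) (Y : ℕ → Ω → ℝ)

/-- The training sample. -/
def train (n : ℕ) (ω : Ω) : Fin n → 𝒳 × ℝ := fun i => (X i ω, Y i ω)

/-- The calibration sample. -/
def calib (n : ℕ) (ω : Ω) : Fin n → 𝒳 × ℝ := fun i => (X (n + i) ω, Y (n + i) ω)

/-- The bins of the prediction interval at the test point, for the estimator `pihat` (a function of
the training sample, the features and the bin), `m_n = ⌊1 / η_n⌋` bins and `T_n = n`. -/
def chat (C α : ℝ) (η : ℕ → ℝ) (ρ : ℕ → Finset (ℕ × ℕ) → ℕ × ℕ) (t₀ : ℕ → ℕ)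
    (pihat : (n : ℕ) → (Fin n → 𝒳 × ℝ) → 𝒳 → ℕ → ℝ) (n : ℕ) (ω : Ω) : ℕ × ℕ :=
  predict C α (ρ n) (numBins η n) n (t₀ n) (pihat n (train X Y n ω)) (calib X Y n ω) (X (2 * n) ω)

/-- The event that the prediction interval contains the test response. -/
def covered (C α : ℝ) (η : ℕ → ℝ) (ρ : ℕ → Finset (ℕ × ℕ) → ℕ × ℕ) (t₀ : ℕ → ℕ)
    (pihat : (n : ℕ) → (Fin n → 𝒳 × ℝ) → 𝒳 → ℕ → ℝ) (n : ℕ) : Set Ω :=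
  {ω | Y (2 * n) ω ∈ toSet C (numBins η n) (chat X Y C α η ρ t₀ pihat n ω)}

/-- The σ-algebra generated by the test features. -/
abbrev sigmaTest [MeasurableSpace 𝒳] (n : ℕ) : MeasurableSpace Ω :=
  MeasurableSpace.comap (X (2 * n)) inferInstance

/-- The σ-algebra generated by the training sample, the calibration sample and the test features. -/
abbrev sigmaData [MeasurableSpace 𝒳] (n : ℕ) : MeasurableSpace Ω :=
  MeasurableSpace.comap (fun ω => (train X Y n ω, calib X Y n ω, X (2 * n) ω)) inferInstance

end Sample

end CHR

end

/-!
# Length and conditional coverage of conformal histogram regression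

The estimated histogram enters the proof only through `sqErr`, the sum over the `m ≤ 1 / η` bin
edges of the squared errors of the estimated distribution function. An interval of bins has two
end points, so its masses under the histogram and under the true density differ by at most
`s + sqErr / (2 s)` for every `s > 0` (`IsDensityOn.abs_mass_sub_trueMass_le`). Put
`s = η ^ (1 / 3)`. Outside of an event of probability `η`, the training sample is good: `sqErr`
has mean at most `m η ^ 2 ≤ η = s ^ 3` at a new feature vector, so it is below `s ^ 2` with
probability at least `1 - s`, and the two masses of every interval then differ by at most
`3 / 2 * s`.

The intervals `S_t` are shortest ones, so an end bin that the nesting does not force could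
otherwise be dropped; hence the histogram gives `S_t` a mass between `t / n` and `t / n + K η`
(`isTight_nested`). For a good training sample, the probability that a calibration response lies
in `S_t` is thus `t / n` up to `3 / 2 * s + K η`, and Hoeffding's inequality, at a single fixed
index on each side, transfers this to the empirical frequency. As the scores are at most `t`
exactly for the responses in `S_t`, this locates the calibrated level `t̂ / n` near `1 - α`
(`Setting.le_level_calIndex`, `Setting.level_calIndex_le`).

*Coverage.* Given all the data, the conditional coverage is the true mass of the interval, which
is at least `t̂ / n` up to the error of the histogram. Given the features alone, it is the average
of that mass over the two samples: the exceptional samples cost at most their probability, and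
Markov's inequality is applied to `sqErr` averaged over the good training samples
(`Setting.measure_sq_le_integral_indicator_le`).

*Length.* The oracle interval, widened by a length of `K d` inside `[-C, C]`, fills `[-C, C]` or
gains a mass of at least `d`, because the density is at least `1 / K`. Its cover by bins is
therefore feasible for the starting level, which bounds the starting interval; each bin added
later costs mass, hence length at most `K` times the increase of the level
(`IsDensityOn.len_nested_le`).
-/

noncomputable section

namespace CHR

/-! ### Shortest feasible intervals of bins -/

section Histogram

variable {m : ℕ} {π : ℕ → ℝ} {Slo Shi : Finset ℕ} {τ M : ℝ} {I : ℕ × ℕ}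

theorem mem_feasible : I ∈ feasible m π Slo Shi τ ↔
    1 ≤ I.1 ∧ I.1 ≤ I.2 ∧ I.2 ≤ m ∧ τ ≤ mass π I ∧ Slo ⊆ bins I ∧ bins I ⊆ Shi := by
  simp only [feasible, Finset.mem_filter, Finset.mem_product, Finset.mem_Icc]
  constructor
  · rintro ⟨⟨⟨h1, h2⟩, h3, h4⟩, h5, h6⟩
    exact ⟨h1, h5, h4, h6⟩
  · rintro ⟨h1, h2, h3, h4⟩
    exact ⟨⟨⟨h1, by omega⟩, by omega, h3⟩, h2, h4⟩

theorem solutions_nonempty (h : (feasible m π Slo Shi τ).Nonempty) :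
    (solutions m π Slo Shi τ).Nonempty := by
  classical
  obtain ⟨I, hI, hmin⟩ := Finset.exists_min_image _ (fun I : ℕ × ℕ => I.2 - I.1) h
  obtain ⟨J, hJ, hJmin⟩ := Finset.exists_min_image
    ((feasible m π Slo Shi τ).filter fun J => J.2 - J.1 = I.2 - I.1) (mass π) ⟨I, by simp [hI]⟩
  simp only [Finset.mem_filter, and_imp, Prod.forall] at hJ hJmin
  refine ⟨J, ?_⟩
  simp only [solutions, Finset.mem_filter]
  refine ⟨hJ.1, fun L hL => ?_⟩
  rcases (hmin L hL).lt_or_eq with hlt | heq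
  · left; omega
  · right; exact ⟨by omega, hJmin L.1 L.2 hL heq.symm⟩

theorem mem_feasible_of_mem_solutions (h : I ∈ solutions m π Slo Shi τ) :
    I ∈ feasible m π Slo Shi τ := by
  classical
  exact (Finset.mem_filter.1 h).1

theorem length_le_of_mem_solutions (h : I ∈ solutions m π Slo Shi τ) {J : ℕ × ℕ}
    (hJ : J ∈ feasible m π Slo Shi τ) : I.2 - I.1 ≤ J.2 - J.1 := by
  classical
  rcases (Finset.mem_filter.1 h).2 J hJ with h | h <;> omega

theorem mass_eq_of_eq (a : ℕ) : mass π (a, a) = π a := by simp [mass, bins]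

theorem mass_succ {a b : ℕ} (h : a ≤ b + 1) : mass π (a, b + 1) = mass π (a, b) + π (b + 1) := by
  simp only [mass, bins]
  rw [← Finset.insert_Icc_right_eq_Icc_add_one h, Finset.sum_insert (by simp)]; ring

theorem mass_eq_add {a b : ℕ} (h : a ≤ b) : mass π (a, b) = π a + mass π (a + 1, b) := by
  simp only [mass, bins]
  rw [← Finset.insert_Icc_add_one_left_eq_Icc h, Finset.sum_insert (by simp)]

/-- A shortest feasible interval exceeds its level by at most one bin, because an end bin outside of
the prescribed inner interval `Slo` could otherwise be dropped. -/
theorem mass_le_of_mem_solutions (hτ : 0 ≤ τ) (hM : ∀ j ∈ Finset.Icc 1 m, π j ≤ M)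
    (hSlo : ∀ a b c, a ∈ Slo → c ∈ Slo → a ≤ b → b ≤ c → b ∈ Slo)
    (h : I ∈ solutions m π Slo Shi τ) : mass π I ≤ τ + M ∨ bins I ⊆ Slo := by
  obtain ⟨a, b⟩ := I
  have hI := mem_feasible.1 (mem_feasible_of_mem_solutions h)
  obtain ⟨h1, h2, h3, h4, h5, h6⟩ := hI
  simp only at h1 h2 h3
  rcases h2.eq_or_lt with rfl | hlt
  · left
    rw [mass_eq_of_eq]
    have := hM a (by simp [h1, h3])
    linarith
  by_cases hb : b ∈ Slo
  · by_cases ha : a ∈ Slo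
    · right
      intro j hj
      simp only [bins, Finset.mem_Icc] at hj
      exact hSlo a j b ha hb hj.1 hj.2
    · left
      by_contra hcon
      push Not at hcon
      have hm := mass_eq_add (π := π) h2
      have hpa := hM a (by simp; omega)
      have hJ : (a + 1, b) ∈ feasible m π Slo Shi τ := by
        refine mem_feasible.2 ⟨by simp, by simp; omega, h3, by linarith, fun j hj => ?_,
          fun j hj => ?_⟩
        · have := h5 hj
          simp only [bins, Finset.mem_Icc] at this ⊢
          have : j ≠ a := by rintro rfl; exact ha hj
          omega
        · apply h6
          simp only [bins, Finset.mem_Icc] at hj ⊢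
          omega
      have := length_le_of_mem_solutions h hJ
      simp only at this
      omega
  · left
    by_contra hcon
    push Not at hcon
    obtain ⟨b, rfl⟩ : ∃ b', b = b' + 1 := ⟨b - 1, by omega⟩
    have hm := mass_succ (π := π) h2
    have hpa := hM (b + 1) (by simp; omega)
    have hJ : (a, b) ∈ feasible m π Slo Shi τ := by
      refine mem_feasible.2 ⟨h1, by simp; omega, by simp; omega, by linarith, fun j hj => ?_,
        fun j hj => ?_⟩
      · have := h5 hj
        simp only [bins, Finset.mem_Icc] at this ⊢
        have : j ≠ b + 1 := by rintro rfl; exact hb hj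
        omega
      · apply h6
        simp only [bins, Finset.mem_Icc] at hj ⊢
        omega
    have := length_le_of_mem_solutions h hJ
    simp only at this
    omega

end Histogram

/-! ### The nested sequence of intervals -/

section Nested

/-- The interval `I` consists of bins from `1, …, m` and has mass between `τ` and `τ + M`. -/
structure IsTight (m : ℕ) (π : ℕ → ℝ) (M τ : ℝ) (I : ℕ × ℕ) : Prop where
  one_le : 1 ≤ I.1
  le : I.1 ≤ I.2
  le_bins : I.2 ≤ m
  le_mass : τ ≤ mass π I
  mass_le : mass π I ≤ τ + M

variable {ρ : Finset (ℕ × ℕ) → ℕ × ℕ} {m T t₀ : ℕ} {π : ℕ → ℝ} {M : ℝ}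

theorem level_nonneg (T t : ℕ) : 0 ≤ level T t := by unfold level; positivity

theorem level_le_one {t : ℕ} (ht : t ≤ T) : level T t ≤ 1 := by
  unfold level
  exact div_le_one_of_le₀ (by exact_mod_cast ht) (by positivity)

theorem level_mono (T : ℕ) {t t' : ℕ} (h : t ≤ t') : level T t ≤ level T t' := by
  unfold level
  gcongr

theorem bins_subset_bins {I J : ℕ × ℕ} (hI : I.1 ≤ I.2) :
    bins I ⊆ bins J ↔ J.1 ≤ I.1 ∧ I.2 ≤ J.2 := by
  simp only [bins]
  exact Finset.Icc_subset_Icc_iff hI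

theorem bins_convex (I : ℕ × ℕ) :
    ∀ a b c, a ∈ bins I → c ∈ bins I → a ≤ b → b ≤ c → b ∈ bins I := by
  intro a b c ha hc hab hbc
  simp only [bins, Finset.mem_Icc] at *
  omega

section

variable (hρ : ∀ A : Finset (ℕ × ℕ), A.Nonempty → ρ A ∈ A) (hm : 1 ≤ m) (hπ : IsHistogram m π)
include hρ hm hπ

theorem start_mem {τ : ℝ} (hτ : τ ≤ 1) :
    ρ (solutions m π ∅ (Finset.Icc 1 m) τ) ∈ solutions m π ∅ (Finset.Icc 1 m) τ := by
  refine hρ _ (solutions_nonempty ⟨(1, m), mem_feasible.2 ⟨le_rfl, hm, le_rfl, ?_, by simp, ?_⟩⟩)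
  · simpa [mass, bins, hπ.2] using hτ
  · simp [bins]

variable (hM : ∀ j ∈ Finset.Icc 1 m, π j ≤ M)
include hM

theorem isTight_start (ht₀ : t₀ ≤ T) :
    IsTight m π M (level T t₀) (ρ (solutions m π ∅ (Finset.Icc 1 m) (level T t₀))) := by
  have h := start_mem hρ hm hπ (level_le_one ht₀)
  have hf := mem_feasible.1 (mem_feasible_of_mem_solutions h)
  refine ⟨hf.1, hf.2.1, hf.2.2.1, hf.2.2.2.1, ?_⟩
  rcases mass_le_of_mem_solutions (level_nonneg T t₀) hM (by simp) h with h' | h'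
  · exact h'
  · rw [Finset.subset_empty] at h'
    simp only [bins, Finset.Icc_eq_empty_iff] at h'
    exact absurd hf.2.1 h'

theorem isTight_up_and_subset (k : ℕ) (hk : t₀ + k ≤ T) :
    IsTight m π M (level T (t₀ + k)) (up ρ m T t₀ π k) ∧
      (∀ i, k = i + 1 → bins (up ρ m T t₀ π i) ⊆ bins (up ρ m T t₀ π k)) := by
  induction k with
  | zero => exact ⟨isTight_start hρ hm hπ hM hk, by simp⟩
  | succ k ih =>
    obtain ⟨ih, -⟩ := ih (by omega)
    have h : up ρ m T t₀ π (k + 1) ∈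
        solutions m π (bins (up ρ m T t₀ π k)) (Finset.Icc 1 m) (level T (t₀ + (k + 1))) := by
      refine hρ _ (solutions_nonempty ⟨(1, m), mem_feasible.2 ⟨le_rfl, hm, le_rfl, ?_, ?_, ?_⟩⟩)
      · simpa [mass, bins, hπ.2] using level_le_one hk
      · exact (bins_subset_bins ih.le).2 ⟨ih.one_le, ih.le_bins⟩
      · simp [bins]
    have hf := mem_feasible.1 (mem_feasible_of_mem_solutions h)
    refine ⟨⟨hf.1, hf.2.1, hf.2.2.1, hf.2.2.2.1, ?_⟩, ?_⟩
    · rcases mass_le_of_mem_solutions (level_nonneg T _) hM (bins_convex _) h with h' | h'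
      · exact h'
      · have heq : bins (up ρ m T t₀ π (k + 1)) = bins (up ρ m T t₀ π k) :=
          h'.antisymm hf.2.2.2.2.1
        have : mass π (up ρ m T t₀ π (k + 1)) = mass π (up ρ m T t₀ π k) := by
          unfold mass; rw [heq]
        rw [this]
        exact ih.mass_le.trans (by gcongr; exact level_mono T (by omega))
    · rintro i hi
      obtain rfl : k = i := by omega
      exact hf.2.2.2.2.1

theorem isTight_down_and_subset (ht₀ : t₀ ≤ T) (k : ℕ) (hk : k ≤ t₀) :
    IsTight m π M (level T (t₀ - k)) (down ρ m T t₀ π k) ∧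
      (∀ i, k = i + 1 → bins (down ρ m T t₀ π k) ⊆ bins (down ρ m T t₀ π i)) := by
  induction k with
  | zero => exact ⟨isTight_start hρ hm hπ hM ht₀, by simp⟩
  | succ k ih =>
    obtain ⟨ih, -⟩ := ih (by omega)
    have h : down ρ m T t₀ π (k + 1) ∈
        solutions m π ∅ (bins (down ρ m T t₀ π k)) (level T (t₀ - (k + 1))) := by
      refine hρ _ (solutions_nonempty ⟨down ρ m T t₀ π k,
        mem_feasible.2 ⟨ih.one_le, ih.le, ih.le_bins, ?_, by simp, subset_rfl⟩⟩)
      exact (level_mono T (by omega)).trans ih.le_mass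
    have hf := mem_feasible.1 (mem_feasible_of_mem_solutions h)
    refine ⟨⟨hf.1, hf.2.1, hf.2.2.1, hf.2.2.2.1, ?_⟩, ?_⟩
    · rcases mass_le_of_mem_solutions (level_nonneg T _) hM (by simp) h with h' | h'
      · exact h'
      · rw [Finset.subset_empty] at h'
        simp only [bins, Finset.Icc_eq_empty_iff] at h'
        exact absurd hf.2.1 h'
    · rintro i hi
      obtain rfl : k = i := by omega
      exact hf.2.2.2.2.2

theorem isTight_nested (ht₀ : t₀ ≤ T) {t : ℕ} (ht : t ≤ T) :
    IsTight m π M (level T t) (nested ρ m T t₀ π t) := by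
  unfold nested
  split_ifs with h
  · have := (isTight_up_and_subset hρ hm hπ hM (t - t₀) (T := T) (t₀ := t₀) (by omega)).1
    rwa [Nat.add_sub_cancel' h] at this
  · have := (isTight_down_and_subset hρ hm hπ hM ht₀ (t₀ - t) (by omega)).1
    rwa [Nat.sub_sub_self (by omega)] at this

theorem bins_nested_mono (ht₀ : t₀ ≤ T) {t t' : ℕ} (h : t ≤ t') (ht' : t' ≤ T) :
    bins (nested ρ m T t₀ π t) ⊆ bins (nested ρ m T t₀ π t') := by
  induction t', h using Nat.le_induction with
  | base => rfl
  | succ t' h ih =>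
    refine (ih (by omega)).trans ?_
    unfold nested
    by_cases h0 : t₀ ≤ t'
    · rw [if_pos h0, if_pos (by omega)]
      exact (isTight_up_and_subset hρ hm hπ hM (t' + 1 - t₀) (by omega)).2 _ (by omega)
    · rw [if_neg h0]
      have := (isTight_down_and_subset hρ hm hπ hM ht₀ (t₀ - t') (by omega)).2 (t₀ - (t' + 1))
        (by omega)
      split_ifs with h1
      · have e1 : t₀ - (t' + 1) = 0 := by omega
        have e2 : t' + 1 - t₀ = 0 := by omega
        rw [e1] at this
        rw [e2]
        exact this
      · exact this

omit hM in
theorem nested_start_mem (ht₀ : t₀ ≤ T) :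
    nested ρ m T t₀ π t₀ ∈ solutions m π ∅ (Finset.Icc 1 m) (level T t₀) := by
  unfold nested
  rw [if_pos le_rfl, Nat.sub_self]
  exact start_mem hρ hm hπ (level_le_one ht₀)

end

end Nested

/-! ### Scores and their order statistics -/

section Scores

variable {C : ℝ} {m T : ℕ}

theorem edge_mono (hC : 0 ≤ C) (m : ℕ) : Monotone (edge C m) := by
  intro i j hij
  unfold edge
  gcongr

theorem toSet_subset (hC : 0 ≤ C) {I J : ℕ × ℕ} (hI : I.1 ≤ I.2) (h : bins I ⊆ bins J) :
    toSet C m I ⊆ toSet C m J := by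
  obtain ⟨h1, h2⟩ := (bins_subset_bins hI).1 h
  exact Set.Ico_subset_Ico (edge_mono hC m (by omega)) (edge_mono hC m h2)

theorem score_le {S : ℕ → ℕ × ℕ} {y : ℝ} : score C m T S y ≤ T := Nat.sInf_le (by simp)

theorem score_le_iff {S : ℕ → ℕ × ℕ} {y : ℝ} {t : ℕ} (ht : t < T)
    (hS : ∀ i j, i ≤ j → j ≤ T → toSet C m (S i) ⊆ toSet C m (S j)) :
    score C m T S y ≤ t ↔ y ∈ toSet C m (S t) := by
  constructor
  · intro h
    have hmem : score C m T S y ∈ {t : ℕ | t = T ∨ (t < T ∧ y ∈ toSet C m (S t))} :=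
      Nat.sInf_mem ⟨T, by simp⟩
    rcases hmem with h' | h'
    · omega
    · exact hS _ _ h ht.le h'.2
  · intro h
    exact Nat.sInf_le (by simp [ht, h])

variable {n k t : ℕ} {E : Fin n → ℕ}

theorem exists_le_card (hE : ∀ i, E i ≤ T) (hk : k ≤ n) :
    k ≤ (Finset.univ.filter fun i => E i ≤ T).card := by
  simpa [Finset.filter_true_of_mem (fun i _ => hE i)] using hk

theorem kthSmallest_le (hE : ∀ i, E i ≤ T) : kthSmallest T k E ≤ T := by
  unfold kthSmallest
  split_ifs with h
  · refine Nat.sInf_le ?_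
    have := exists_le_card hE h
    simp only [Set.mem_ofPred_eq]
    convert this
  · rfl

theorem kthSmallest_le_of_le_card (h : k ≤ (Finset.univ.filter fun i => E i ≤ t).card) :
    kthSmallest T k E ≤ t := by
  have hk : k ≤ n := h.trans ((Finset.card_le_univ _).trans (by simp))
  unfold kthSmallest
  rw [if_pos hk]
  refine Nat.sInf_le ?_
  simp only [Set.mem_ofPred_eq]
  convert h

theorem lt_kthSmallest_of_card_lt (hE : ∀ i, E i ≤ T) (ht : t < T)
    (h : (Finset.univ.filter fun i => E i ≤ t).card < k) : t < kthSmallest T k E := by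
  classical
  unfold kthSmallest
  split_ifs with hk
  · by_contra hcon
    push Not at hcon
    have hmem : sInf {t : ℕ | k ≤ (Finset.univ.filter fun i => E i ≤ t).card} ∈
        {t : ℕ | k ≤ (Finset.univ.filter fun i => E i ≤ t).card} :=
      Nat.sInf_mem ⟨T, exists_le_card hE hk⟩
    have h1 : k ≤ (Finset.univ.filter fun i => E i ≤ t).card := by
      refine le_trans hmem (Finset.card_le_card ?_)
      intro i hi
      simp only [Finset.mem_filter, Finset.mem_univ, true_and] at hi ⊢
      refine hi.trans ?_
      convert hcon
    omega
  · exact ht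

end Scores

/-! ### Distribution functions of densities on `[-C, C]` -/

/-- `g` is a probability density which vanishes outside `[-C, C]` and is at least `1 / K` on this
interval. -/
structure IsDensityOn (C K : ℝ) (g : ℝ → ℝ) : Prop where
  measurable : Measurable g
  nonneg : ∀ y, 0 ≤ g y
  lintegral_eq_one : ∫⁻ y, ENNReal.ofReal (g y) = 1
  eq_zero : ∀ y ∉ Set.Icc (-C) C, g y = 0
  le_apply : ∀ y ∈ Set.Icc (-C) C, 1 / K ≤ g y

/-- The probability of the interval covered by the bins `I = (l, u)` under the density `g`. -/
def trueMass (g : ℝ → ℝ) (C : ℝ) (m : ℕ) (I : ℕ × ℕ) : ℝ :=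
  cdfOf g (edge C m I.2) - cdfOf g (edge C m (I.1 - 1))

/-- The sum over the bin edges of the squared differences between the distribution functions of the
histogram `π` and of the density `g`. -/
def sqErr (C : ℝ) (m : ℕ) (π : ℕ → ℝ) (g : ℝ → ℝ) : ℝ :=
  ∑ j ∈ Finset.Icc 1 m, (∑ i ∈ Finset.Icc 1 j, π i - cdfOf g (edge C m j)) ^ 2

theorem sqErr_nonneg (C : ℝ) (m : ℕ) (π : ℕ → ℝ) (g : ℝ → ℝ) : 0 ≤ sqErr C m π g :=
  Finset.sum_nonneg fun _ _ => sq_nonneg _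

theorem edge_zero (C : ℝ) (m : ℕ) : edge C m 0 = -C := by simp [edge]

theorem edge_self {m : ℕ} (hm : 1 ≤ m) (C : ℝ) : edge C m m = C := by
  have : (m : ℝ) ≠ 0 := by positivity
  unfold edge
  field_simp
  ring

theorem edge_mem_Icc {C : ℝ} (hC : 0 ≤ C) {m j : ℕ} (hm : 1 ≤ m) (hj : j ≤ m) :
    edge C m j ∈ Set.Icc (-C) C :=
  ⟨edge_zero C m ▸ edge_mono hC m (Nat.zero_le j), (edge_mono hC m hj).trans_eq (edge_self hm C)⟩

theorem len_le_two_mul {C : ℝ} (hC : 0 ≤ C) {m : ℕ} {I : ℕ × ℕ} (hI1 : 1 ≤ I.1)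
    (hI : I.1 ≤ I.2) (hIm : I.2 ≤ m) :
    len C m I ≤ 2 * C := by
  have h1 := (edge_mem_Icc hC (show 1 ≤ m by omega) (show I.1 - 1 ≤ m by omega)).1
  have h2 := (edge_mem_Icc hC (show 1 ≤ m by omega) hIm).2
  unfold len
  linarith

namespace IsDensityOn

variable {C K : ℝ} {g : ℝ → ℝ} (hg : IsDensityOn C K g)
include hg

theorem integrable : Integrable g := by
  refine ⟨hg.measurable.aestronglyMeasurable, ?_⟩
  rw [hasFiniteIntegral_iff_ofReal (ae_of_all _ hg.nonneg), hg.lintegral_eq_one]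
  exact ENNReal.one_lt_top

theorem integral_eq_one : ∫ y, g y = 1 := by
  rw [integral_eq_lintegral_of_nonneg_ae (ae_of_all _ hg.nonneg)
    hg.measurable.aestronglyMeasurable, hg.lintegral_eq_one]
  rfl

theorem cdfOf_sub (a b : ℝ) : cdfOf g b - cdfOf g a = ∫ y in a..b, g y :=
  intervalIntegral.integral_Iic_sub_Iic hg.integrable.integrableOn hg.integrable.integrableOn

theorem cdfOf_mono : Monotone (cdfOf g) := fun _ _ hab =>
  setIntegral_mono_set hg.integrable.integrableOn (ae_of_all _ hg.nonneg)
    (Set.Iic_subset_Iic.2 hab).eventuallyLE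

theorem cdfOf_nonneg (y : ℝ) : 0 ≤ cdfOf g y := integral_nonneg hg.nonneg

theorem cdfOf_le_one (y : ℝ) : cdfOf g y ≤ 1 := by
  rw [← hg.integral_eq_one]
  exact setIntegral_le_integral hg.integrable (ae_of_all _ hg.nonneg)

theorem cdfOf_eq_zero {y : ℝ} (hy : y ≤ -C) : cdfOf g y = 0 := by
  have : cdfOf g y = ∫ s in Set.Iio y, g s := integral_Iic_eq_integral_Iio
  rw [this]
  refine setIntegral_eq_zero_of_forall_eq_zero fun s hs => hg.eq_zero s fun h => ?_
  exact absurd (lt_of_lt_of_le hs hy) (not_lt.2 h.1)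

theorem cdfOf_eq_one {y : ℝ} (hy : C ≤ y) : cdfOf g y = 1 := by
  have h := intervalIntegral.integral_Iic_add_Ioi (μ := volume) (b := y)
    hg.integrable.integrableOn hg.integrable.integrableOn
  rw [hg.integral_eq_one] at h
  have h0 : ∫ s in Set.Ioi y, g s = 0 :=
    setIntegral_eq_zero_of_forall_eq_zero fun s hs => hg.eq_zero s fun h =>
      absurd (lt_of_le_of_lt hy hs) (not_lt.2 h.2)
  rw [h0, add_zero] at h
  exact h

theorem sub_le_cdfOf_sub {u v : ℝ} (hu : -C ≤ u) (huv : u ≤ v) (hv : v ≤ C) :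
    (v - u) / K ≤ cdfOf g v - cdfOf g u := by
  rw [hg.cdfOf_sub]
  have h : ∫ _ in u..v, (1 / K) = (v - u) / K := by simp [div_eq_mul_inv]
  rw [← h]
  exact intervalIntegral.integral_mono_on huv (by simp) hg.integrable.intervalIntegrable
    fun y hy => hg.le_apply y ⟨hu.trans hy.1, hy.2.trans hv⟩

theorem cdfOf_clamp (hC : 0 ≤ C) (y : ℝ) : cdfOf g (max (-C) (min C y)) = cdfOf g y := by
  rcases le_total y (-C) with h | h
  · rw [min_eq_right (by linarith), max_eq_left h, hg.cdfOf_eq_zero h, hg.cdfOf_eq_zero le_rfl]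
  · rcases le_total y C with h' | h'
    · rw [min_eq_right h', max_eq_right h]
    · rw [min_eq_left h', max_eq_right (by linarith), hg.cdfOf_eq_one h', hg.cdfOf_eq_one le_rfl]

theorem two_mul_le (hC : 0 ≤ C) (hK : 0 < K) : 2 * C ≤ K := by
  have h := hg.sub_le_cdfOf_sub le_rfl (by linarith) (le_refl C)
  rw [hg.cdfOf_eq_one le_rfl, hg.cdfOf_eq_zero le_rfl, div_le_iff₀ hK] at h
  linarith

theorem lintegral_Ico {a b : ℝ} (hab : a ≤ b) :
    ∫⁻ y in Set.Ico a b, ENNReal.ofReal (g y) = ENNReal.ofReal (cdfOf g b - cdfOf g a) := by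
  rw [hg.cdfOf_sub, intervalIntegral.integral_of_le hab, ← integral_Ico_eq_integral_Ioc,
    ofReal_integral_eq_lintegral_ofReal hg.integrable.integrableOn (ae_of_all _ hg.nonneg)]

/-! ### Mass of a histogram and of a density on an interval of bins -/

variable {m : ℕ} {π : ℕ → ℝ}

theorem trueMass_mem_Icc (hC : 0 ≤ C) {I : ℕ × ℕ} (hI : I.1 ≤ I.2) :
    trueMass g C m I ∈ Set.Icc 0 1 := by
  have h1 := hg.cdfOf_mono (edge_mono hC m (show I.1 - 1 ≤ I.2 by omega))
  have h2 := hg.cdfOf_le_one (edge C m I.2)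
  have h3 := hg.cdfOf_nonneg (edge C m (I.1 - 1))
  unfold trueMass
  constructor <;> linarith

/-- On a single interval the masses of the histogram and the density differ by the errors of the
distribution function at the two end points. -/
theorem abs_mass_sub_trueMass_le {s : ℝ} (hs : 0 < s) {I : ℕ × ℕ} (h1 : 1 ≤ I.1)
    (h2 : I.1 ≤ I.2) (h3 : I.2 ≤ m) :
    |mass π I - trueMass g C m I| ≤ s + sqErr C m π g / (2 * s) := by
  set e : ℕ → ℝ := fun j => ∑ i ∈ Finset.Icc 1 j, π i - cdfOf g (edge C m j) with he
  have hdiff : mass π I - trueMass g C m I = e I.2 - e (I.1 - 1) := by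
    have hsplit : ∑ i ∈ Finset.Icc 1 I.2, π i =
        ∑ i ∈ Finset.Icc 1 (I.1 - 1), π i + mass π I := by
      have hd : Finset.Icc 1 I.2 = Finset.Icc 1 (I.1 - 1) ∪ bins I := by
        ext j; simp only [bins, Finset.mem_union, Finset.mem_Icc]; omega
      rw [hd, Finset.sum_union]
      · rfl
      · rw [Finset.disjoint_left]
        intro j hj hj'
        simp only [bins, Finset.mem_Icc] at hj hj'
        omega
    simp only [he, trueMass, hsplit]
    ring
  have hsq : e I.2 ^ 2 + e (I.1 - 1) ^ 2 ≤ sqErr C m π g := by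
    have hsum : sqErr C m π g = ∑ j ∈ Finset.Icc 1 m, e j ^ 2 := rfl
    rw [hsum]
    rcases Nat.eq_zero_or_pos (I.1 - 1) with h0 | hpos
    · have : e (I.1 - 1) = 0 := by simp [he, h0, edge_zero, hg.cdfOf_eq_zero]
      rw [this]
      have := Finset.single_le_sum (f := fun j => e j ^ 2) (fun j _ => sq_nonneg _)
        (Finset.mem_Icc.2 ⟨h1.trans h2, h3⟩)
      simpa using this
    · have hne : I.2 ≠ I.1 - 1 := by omega
      rw [← Finset.sum_pair (f := fun j => e j ^ 2) hne]
      refine Finset.sum_le_sum_of_subset_of_nonneg ?_ fun _ _ _ => sq_nonneg _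
      intro j hj
      simp only [Finset.mem_insert, Finset.mem_singleton, Finset.mem_Icc] at hj ⊢
      omega
  rw [hdiff]
  -- The inequality of arithmetic and geometric means keeps the error linear in `sqErr`.
  have habs : ∀ x : ℝ, |x| ≤ s / 2 + x ^ 2 / (2 * s) := by
    intro x
    have h : s / 2 + x ^ 2 / (2 * s) - |x| = (|x| - s) ^ 2 / (2 * s) := by
      rw [← sq_abs x]; field_simp; ring
    have : 0 ≤ (|x| - s) ^ 2 / (2 * s) := by positivity
    linarith
  calc |e I.2 - e (I.1 - 1)| ≤ |e I.2| + |e (I.1 - 1)| := abs_sub _ _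
    _ ≤ s + (e I.2 ^ 2 + e (I.1 - 1) ^ 2) / (2 * s) := by
      have := habs (e I.2)
      have := habs (e (I.1 - 1))
      rw [add_div]
      linarith
    _ ≤ _ := by gcongr

/-! ### Lengths of intervals of bins -/

/-- The shortest interval of level `τ` can be widened, within `[-C, C]`, by a total length of `d`,
which adds a mass of at least `d / K`, and then be covered by bins. -/
theorem exists_cover (hC : 0 < C) (hm : 1 ≤ m) {τ d : ℝ} (hd : 0 < d) {I : ℝ × ℝ}
    (hI : IsOracleInterval g τ I) :
    ∃ J : ℕ × ℕ, 1 ≤ J.1 ∧ J.1 ≤ J.2 ∧ J.2 ≤ m ∧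
      len C m J ≤ (I.2 - I.1) + d + 4 * C / m ∧ (J = (1, m) ∨ τ + d / K ≤ trueMass g C m J) := by
  obtain ⟨⟨hle, hmass⟩, -⟩ := hI
  have hm0 : (0 : ℝ) < m := by exact_mod_cast hm
  rw [← hg.cdfOf_sub, ← hg.cdfOf_clamp hC.le I.1, ← hg.cdfOf_clamp hC.le I.2] at hmass
  set l := max (-C) (min C I.1)
  set u := max (-C) (min C I.2)
  have hlu : l ≤ u := max_le_max_left _ (min_le_min_left _ hle)
  have hlen : u - l ≤ I.2 - I.1 := by
    have h1 : |u - l| ≤ |min C I.2 - min C I.1| := by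
      have := abs_max_sub_max_le_max (-C) (min C I.2) (-C) (min C I.1)
      simpa using this
    have h2 : |min C I.2 - min C I.1| ≤ |I.2 - I.1| := by
      have := abs_min_sub_min_le_max C I.2 C I.1
      simpa using this
    rw [abs_of_nonneg (by linarith)] at h1
    rw [abs_of_nonneg (show 0 ≤ I.2 - I.1 by linarith)] at h2
    linarith
  have hl : -C ≤ l := le_max_left _ _
  have hu : u ≤ C := max_le (by linarith) (min_le_left _ _)
  have hw : 0 ≤ 4 * C / m := by positivity
  rcases le_or_gt (2 * C) (u - l + d) with hbig | hsmall
  · refine ⟨(1, m), le_rfl, hm, le_rfl, ?_, Or.inl rfl⟩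
    simp only [len, edge_self hm, Nat.sub_self, edge_zero]
    linarith
  -- Widen to the right first, and to the left by whatever did not fit into `[-C, C]`.
  obtain ⟨l', u', hl', hll, huu, hu', hsum⟩ : ∃ l' u' : ℝ, -C ≤ l' ∧ l' ≤ l ∧ u ≤ u' ∧ u' ≤ C ∧
      u' - l' = u - l + d := by
    rcases le_total (u + d) C with h | h
    · exact ⟨l, u + d, hl, le_rfl, by linarith, h, by ring⟩
    · exact ⟨l - d + C - u, C, by linarith, by linarith, hu, le_rfl, by ring⟩
  have hmass' : τ + d / K ≤ cdfOf g u' - cdfOf g l' := by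
    have h1 := hg.sub_le_cdfOf_sub hl' hll (hlu.trans hu)
    have h2 := hg.sub_le_cdfOf_sub (hl.trans hlu) huu hu'
    have h3 : d / K = (l - l') / K + (u' - u) / K := by
      rw [← add_div]; congr 1; linarith
    linarith
  have hedge : ∀ j : ℕ, edge C m j = -C + 2 * C / m * j := fun j => by unfold edge; ring
  set w := 2 * C / m with hw_def
  have hw0 : 0 < w := by positivity
  set a := ⌊(l' + C) / w⌋₊
  set b := ⌈(u' + C) / w⌉₊
  have ha1 : edge C m a ≤ l' := by
    have h := Nat.floor_le (show 0 ≤ (l' + C) / w from div_nonneg (by linarith) hw0.le)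
    rw [le_div_iff₀ hw0] at h
    rw [hedge]; linarith
  have ha2 : l' - w ≤ edge C m a := by
    have h := (Nat.lt_floor_add_one ((l' + C) / w)).le
    rw [div_le_iff₀ hw0] at h
    rw [hedge]; linarith
  have hb1 : u' ≤ edge C m b := by
    have h := Nat.le_ceil ((u' + C) / w)
    rw [div_le_iff₀ hw0] at h
    rw [hedge]; linarith
  have hb2 : edge C m b ≤ u' + w := by
    have h := (Nat.ceil_lt_add_one (show 0 ≤ (u' + C) / w from
      div_nonneg (by linarith) hw0.le)).le
    rw [← sub_le_iff_le_add, le_div_iff₀ hw0] at h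
    rw [hedge]; linarith
  have hbm : b ≤ m := by
    refine Nat.ceil_le.2 ((div_le_iff₀ hw0).2 ?_)
    rw [hw_def]
    field_simp
    linarith
  have hab : a < b := (edge_mono hC.le m).reflect_lt (by linarith)
  refine ⟨(a + 1, b), by simp, hab, hbm, ?_, Or.inr ?_⟩
  · simp only [len, Nat.add_sub_cancel]
    have : 4 * C / m = 2 * w := by rw [hw_def]; ring
    linarith
  · simp only [trueMass, Nat.add_sub_cancel]
    have h1 := hg.cdfOf_mono ha1
    have h2 := hg.cdfOf_mono hb1
    linarith

theorem len_le_len_add (hC : 0 ≤ C) (hK : 0 < K) {I J : ℕ × ℕ} (hI1 : 1 ≤ I.1) (hI : I.1 ≤ I.2)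
    (hJ : J.2 ≤ m) (h : bins I ⊆ bins J) :
    len C m J ≤ len C m I + K * (trueMass g C m J - trueMass g C m I) := by
  obtain ⟨h1, h2⟩ := (bins_subset_bins hI).1 h
  have hm : 1 ≤ m := by omega
  have e1 := hg.sub_le_cdfOf_sub (edge_mem_Icc hC hm (show J.1 - 1 ≤ m by omega)).1
    (edge_mono hC m (show J.1 - 1 ≤ I.1 - 1 by omega)) (edge_mem_Icc hC hm (by omega)).2
  have e2 := hg.sub_le_cdfOf_sub (edge_mem_Icc hC hm (show I.2 ≤ m by omega)).1
    (edge_mono hC m h2) (edge_mem_Icc hC hm (by omega)).2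
  rw [div_le_iff₀ hK] at e1 e2
  simp only [len, trueMass]
  linarith

/-- The interval of level `t / T` is not much longer than an oracle interval of level `τ` if
`t / T` is not much larger than `τ` and the histogram is uniformly close to the density: the
starting interval is at most as long as a cover of the widened oracle interval, and every bin that
the recursion adds costs mass. -/
theorem len_nested_le (hC : 0 < C) (hK : 0 < K) {ρ : Finset (ℕ × ℕ) → ℕ × ℕ} {T t₀ t : ℕ}
    (hρ : ∀ A : Finset (ℕ × ℕ), A.Nonempty → ρ A ∈ A) (hm : 1 ≤ m) (hπ : IsHistogram m π)
    {M δ τ B : ℝ} (hM0 : 0 ≤ M) (hM : ∀ j ∈ Finset.Icc 1 m, π j ≤ M) (hT : 1 ≤ T) (ht₀ : t₀ ≤ T)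
    (ht : t ≤ T) (hlev : |level T t₀ - τ| ≤ 1 / T) (hδ : 0 < δ)
    (hclose : ∀ I : ℕ × ℕ, 1 ≤ I.1 → I.1 ≤ I.2 → I.2 ≤ m → |mass π I - trueMass g C m I| ≤ δ)
    (hB0 : 0 ≤ B) (hB : level T t ≤ τ + B) {I : ℝ × ℝ} (hI : IsOracleInterval g τ I) :
    len C m (nested ρ m T t₀ π t) ≤
      (I.2 - I.1) + 4 * C / m + K * (B + 2 / T + M + 3 * δ) := by
  have hT0 : (0 : ℝ) < 1 / T := by positivity
  have hlev' := abs_le.1 hlev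
  set S₀ := nested ρ m T t₀ π t₀ with hS₀
  have hS₀mem : S₀ ∈ solutions m π ∅ (Finset.Icc 1 m) (level T t₀) :=
    nested_start_mem hρ hm hπ ht₀
  have hS₀tight : IsTight m π M (level T t₀) S₀ := isTight_nested hρ hm hπ hM ht₀ ht₀
  have hStight := isTight_nested hρ hm hπ hM ht₀ ht
  have hstart : len C m S₀ ≤ (I.2 - I.1) + K * (1 / T + δ) + 4 * C / m := by
    obtain ⟨J, hJ1, hJ, hJm, hlen, hJmass⟩ :=
      hg.exists_cover hC hm (show 0 < K * (1 / T + δ) by positivity) hI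
    have hJf : J ∈ feasible m π ∅ (Finset.Icc 1 m) (level T t₀) := by
      refine mem_feasible.2 ⟨hJ1, hJ, hJm, ?_, by simp, ?_⟩
      · rcases hJmass with rfl | h
        · simpa [mass, bins, hπ.2] using level_le_one ht₀
        · rw [mul_div_cancel_left₀ _ hK.ne'] at h
          have := abs_le.1 (hclose J hJ1 hJ hJm)
          linarith
      · exact Finset.Icc_subset_Icc hJ1 hJm
    have hcmp := length_le_of_mem_solutions hS₀mem hJf
    refine le_trans ?_ hlen
    have hedge : ∀ L : ℕ × ℕ, 1 ≤ L.1 → L.1 ≤ L.2 →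
        len C m L = 2 * C / m * ((L.2 - L.1 : ℕ) + 1) := by
      intro L h1 h2
      unfold len edge
      rw [Nat.cast_sub h1, Nat.cast_sub h2]
      push_cast
      ring
    rw [hedge _ hS₀tight.one_le hS₀tight.le, hedge _ hJ1 hJ]
    gcongr
  rcases le_total t t₀ with h | h
  · have hsub := bins_nested_mono hρ hm hπ hM ht₀ h ht₀
    obtain ⟨h1, h2⟩ := (bins_subset_bins hStight.le).1 hsub
    have hlen : len C m (nested ρ m T t₀ π t) ≤ len C m S₀ := by
      unfold len
      have e1 := edge_mono hC.le m h2
      have e2 := edge_mono hC.le m (Nat.sub_le_sub_right h1 1)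
      linarith
    have : K * (1 / T + δ) ≤ K * (B + 2 / T + M + 3 * δ) := by
      have : (2 : ℝ) / T = 1 / T + 1 / T := by ring
      exact mul_le_mul_of_nonneg_left (by linarith) hK.le
    linarith
  · have hsub := bins_nested_mono hρ hm hπ hM ht₀ h ht
    have hlen := hg.len_le_len_add hC.le hK hS₀tight.one_le hS₀tight.le hStight.le_bins hsub
    have h1 := abs_le.1 (hclose _ hS₀tight.one_le hS₀tight.le hS₀tight.le_bins)
    have h2 := abs_le.1 (hclose _ hStight.one_le hStight.le hStight.le_bins)
    have h3 := hS₀tight.le_mass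
    have h4 := hStight.mass_le
    have h5 : trueMass g C m (nested ρ m T t₀ π t) - trueMass g C m S₀ ≤
        B + 1 / T + M + 2 * δ := by linarith
    have h6 := mul_le_mul_of_nonneg_left h5 hK.le
    have h7 : K * (B + 2 / T + M + 3 * δ) = K * (1 / T + δ) + K * (B + 1 / T + M + 2 * δ) := by
      ring
    linarith

end IsDensityOn

/-! ### Measurability of the prediction interval -/

section Measurability

variable {𝒵 : Type*} [MeasurableSpace 𝒵] {π : 𝒵 → ℕ → ℝ}

theorem measurable_of_countable_arg {β γ : Type*} [MeasurableSpace β] [MeasurableSpace γ]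
    [Countable β] [MeasurableSingletonClass β] {G : 𝒵 → β → γ}
    (hG : ∀ b, Measurable fun z => G z b) {b : 𝒵 → β} (hb : Measurable b) :
    Measurable fun z => G z (b z) :=
  (measurable_from_prod_countable_left (f := fun q : 𝒵 × β => G q.1 q.2) hG).comp
    (measurable_id.prodMk hb)

theorem measurable_choice_solutions (hπ : ∀ j, Measurable fun z => π z j)
    (ρ : Finset (ℕ × ℕ) → ℕ × ℕ) (m : ℕ) (Slo Shi : Finset ℕ) (τ : ℝ) :
    Measurable fun z => ρ (solutions m (π z) Slo Shi τ) := by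
  have hmass : ∀ I, Measurable fun z => mass (π z) I := fun I =>
    Finset.measurable_fun_sum _ fun j _ => hπ j
  have hfeas : ∀ I, MeasurableSet {z | I ∈ feasible m (π z) Slo Shi τ} := by
    intro I
    simp only [mem_feasible]
    exact (MeasurableSet.const _).inter <| (MeasurableSet.const _).inter <|
      (MeasurableSet.const _).inter <| (measurableSet_le measurable_const (hmass I)).inter
      (MeasurableSet.const _)
  have hsol : ∀ I, MeasurableSet {z | I ∈ solutions m (π z) Slo Shi τ} := by
    intro I
    have : {z | I ∈ solutions m (π z) Slo Shi τ} = {z | I ∈ feasible m (π z) Slo Shi τ} ∩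
        ⋂ J : ℕ × ℕ, ({z | J ∈ feasible m (π z) Slo Shi τ}ᶜ ∪ ({_z : 𝒵 | I.2 - I.1 < J.2 - J.1} ∪
          ({_z : 𝒵 | I.2 - I.1 = J.2 - J.1} ∩ {z | mass (π z) I ≤ mass (π z) J}))) := by
      ext z
      simp only [solutions, Finset.mem_filter, Set.mem_ofPred_eq, Set.mem_inter_iff, Set.mem_iInter,
        Set.mem_union, Set.mem_compl_iff, imp_iff_not_or]
    rw [this]
    exact (hfeas I).inter <| MeasurableSet.iInter fun J => (hfeas J).compl.union <|
      (MeasurableSet.const _).union <| (MeasurableSet.const _).inter <|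
      measurableSet_le (hmass I) (hmass J)
  have hF : ∀ F, MeasurableSet {z | solutions m (π z) Slo Shi τ = F} := by
    intro F
    have : {z | solutions m (π z) Slo Shi τ = F} =
        ⋂ I : ℕ × ℕ, {z | I ∈ solutions m (π z) Slo Shi τ ↔ I ∈ F} := by
      ext z
      simp [Finset.ext_iff]
    rw [this]
    refine MeasurableSet.iInter fun I => ?_
    by_cases hI : I ∈ F
    · simp only [hI, iff_true]
      exact hsol I
    · simp only [hI, iff_false]
      exact (hsol I).compl
  let : MeasurableSpace (Finset (ℕ × ℕ)) := ⊤
  have hmeas : Measurable fun z => solutions m (π z) Slo Shi τ :=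
    measurable_to_countable' fun F => hF F
  exact (measurable_from_top (f := ρ)).comp hmeas

theorem measurable_up (hπ : ∀ j, Measurable fun z => π z j) (ρ : Finset (ℕ × ℕ) → ℕ × ℕ)
    (m T t₀ k : ℕ) : Measurable fun z => up ρ m T t₀ (π z) k := by
  induction k with
  | zero => exact measurable_choice_solutions hπ ρ m _ _ _
  | succ k ih =>
    exact measurable_of_countable_arg (G := fun z J => ρ (solutions m (π z) (bins J)
      (Finset.Icc 1 m) (level T (t₀ + (k + 1)))))
      (fun J => measurable_choice_solutions hπ ρ m _ _ _) ih

theorem measurable_down (hπ : ∀ j, Measurable fun z => π z j) (ρ : Finset (ℕ × ℕ) → ℕ × ℕ)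
    (m T t₀ k : ℕ) : Measurable fun z => down ρ m T t₀ (π z) k := by
  induction k with
  | zero => exact measurable_choice_solutions hπ ρ m _ _ _
  | succ k ih =>
    exact measurable_of_countable_arg (G := fun z J => ρ (solutions m (π z) ∅ (bins J)
      (level T (t₀ - (k + 1)))))
      (fun J => measurable_choice_solutions hπ ρ m _ _ _) ih

theorem measurable_nested (hπ : ∀ j, Measurable fun z => π z j) (ρ : Finset (ℕ × ℕ) → ℕ × ℕ)
    (m T t₀ : ℕ) {t : 𝒵 → ℕ} (ht : Measurable t) :
    Measurable fun z => nested ρ m T t₀ (π z) (t z) := by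
  refine measurable_of_countable_arg (G := fun z t => nested ρ m T t₀ (π z) t) (fun t => ?_) ht
  unfold nested
  split_ifs
  · exact measurable_up hπ ρ m T t₀ _
  · exact measurable_down hπ ρ m T t₀ _

theorem measurableSet_mem_toSet (C : ℝ) (m : ℕ) {J : 𝒵 → ℕ × ℕ} {y : 𝒵 → ℝ} (hJ : Measurable J)
    (hy : Measurable y) : MeasurableSet {z | y z ∈ toSet C m (J z)} := by
  have h1 : Measurable fun I : ℕ × ℕ => edge C m (I.1 - 1) := Measurable.of_discrete
  have h2 : Measurable fun I : ℕ × ℕ => edge C m I.2 := Measurable.of_discrete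
  exact (measurableSet_le (h1.comp hJ) hy).inter (measurableSet_lt hy (h2.comp hJ))

theorem measurable_score (hπ : ∀ j, Measurable fun z => π z j) (C : ℝ)
    (ρ : Finset (ℕ × ℕ) → ℕ × ℕ) (m T t₀ : ℕ) {y : 𝒵 → ℝ} (hy : Measurable y) :
    Measurable fun z => score C m T (nested ρ m T t₀ (π z)) (y z) := by
  classical
  have hne : ∀ z, ∃ t : ℕ, t = T ∨ (t < T ∧ y z ∈ toSet C m (nested ρ m T t₀ (π z) t)) :=
    fun z => ⟨T, Or.inl rfl⟩
  have hfind := measurable_find hne fun t => (MeasurableSet.const _).union <|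
    (MeasurableSet.const _).inter <| measurableSet_mem_toSet C m
      (measurable_nested hπ ρ m T t₀ (measurable_const (a := t))) hy
  convert hfind using 2 with z
  refine (Nat.sInf_def (hne z)).trans ?_
  congr!

theorem measurable_kthSmallest {n : ℕ} (T k : ℕ) :
    Measurable (kthSmallest T k : (Fin n → ℕ) → ℕ) := Measurable.of_discrete

end Measurability

/-! ### Conditional densities and conditional expectations -/

section Law

variable {𝒳 : Type*} [MeasurableSpace 𝒳] {f : 𝒳 → ℝ → ℝ} {C K : ℝ} {m : ℕ}

theorem measurable_cdfOf (hf : Measurable (Function.uncurry f)) (y : ℝ) :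
    Measurable fun x => cdfOf (f x) y :=
  (hf.stronglyMeasurable.integral_prod_right (ν := volume.restrict (Set.Iic y))).measurable

theorem measurable_trueMass (hf : Measurable (Function.uncurry f)) {𝒵 : Type*} [MeasurableSpace 𝒵]
    {x : 𝒵 → 𝒳} (hx : Measurable x) {J : 𝒵 → ℕ × ℕ} (hJ : Measurable J) :
    Measurable fun z => trueMass (f (x z)) C m (J z) := by
  refine measurable_of_countable_arg (G := fun z J => trueMass (f (x z)) C m J) (fun J => ?_) hJ
  exact ((measurable_cdfOf hf _).comp hx).sub ((measurable_cdfOf hf _).comp hx)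

variable {ν : Measure (𝒳 × ℝ)}

theorem measure_mem_toSet [SFinite ν] (hC : 0 ≤ C) (hf : Measurable (Function.uncurry f))
    (hd : ∀ x, IsDensityOn C K (f x))
    (hν : ν = (ν.fst.prod volume).withDensity fun q => ENNReal.ofReal (f q.1 q.2))
    {J : 𝒳 → ℕ × ℕ} (hJ : Measurable J) (hle : ∀ x, (J x).1 ≤ (J x).2) {B : Set 𝒳}
    (hB : MeasurableSet B) :
    ν {q | q.1 ∈ B ∧ q.2 ∈ toSet C m (J q.1)} =
      ∫⁻ x in B, ENNReal.ofReal (trueMass (f x) C m (J x)) ∂ν.fst := by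
  have hf' : Measurable fun q : 𝒳 × ℝ => ENNReal.ofReal (f q.1 q.2) := hf.ennreal_ofReal
  have hS : MeasurableSet {q : 𝒳 × ℝ | q.1 ∈ B ∧ q.2 ∈ toSet C m (J q.1)} :=
    (measurable_fst hB).inter
      (measurableSet_mem_toSet C m (hJ.comp measurable_fst) measurable_snd)
  conv_lhs => rw [hν]
  rw [withDensity_apply _ hS, ← lintegral_indicator hS, lintegral_prod _
    (hf'.indicator hS).aemeasurable, ← lintegral_indicator hB]
  refine lintegral_congr fun x => ?_
  by_cases hx : x ∈ B
  · rw [Set.indicator_of_mem hx, trueMass, ← (hd x).lintegral_Ico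
      (edge_mono hC m (by have := hle x; omega)), ← lintegral_indicator measurableSet_Ico]
    refine lintegral_congr fun y => ?_
    simp only [Set.indicator, Set.mem_ofPred_eq, hx, true_and, toSet]
  · rw [Set.indicator_of_notMem hx]
    simp [Set.indicator, hx]

/-- The law of `(D, c, (x, y))`, integrated over the response `y`. -/
theorem measure_prod_mem_toSet (hC : 0 ≤ C) (hf : Measurable (Function.uncurry f))
    (hd : ∀ x, IsDensityOn C K (f x))
    (hν : ν = (ν.fst.prod volume).withDensity fun q => ENNReal.ofReal (f q.1 q.2))
    {𝒟 𝒞 : Type*} [MeasurableSpace 𝒟] [MeasurableSpace 𝒞] (P : Measure 𝒟) (Q : Measure 𝒞)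
    [SFinite P] [SFinite Q] [SFinite ν] {J : 𝒟 × 𝒞 × 𝒳 → ℕ × ℕ} (hJ : Measurable J)
    (hle : ∀ w, (J w).1 ≤ (J w).2) {B : Set (𝒟 × 𝒞 × 𝒳)} (hB : MeasurableSet B) :
    (P.prod (Q.prod ν)) {z | (z.1, z.2.1, z.2.2.1) ∈ B ∧
        z.2.2.2 ∈ toSet C m (J (z.1, z.2.1, z.2.2.1))} =
      ∫⁻ w in B, ENNReal.ofReal (trueMass (f w.2.2) C m (J w)) ∂(P.prod (Q.prod ν.fst)) := by
  have hW : Measurable fun z : 𝒟 × 𝒞 × 𝒳 × ℝ => (z.1, z.2.1, z.2.2.1) := by fun_prop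
  have hS : MeasurableSet {z : 𝒟 × 𝒞 × 𝒳 × ℝ | (z.1, z.2.1, z.2.2.1) ∈ B ∧
      z.2.2.2 ∈ toSet C m (J (z.1, z.2.1, z.2.2.1))} :=
    (hW hB).inter (measurableSet_mem_toSet C m (hJ.comp hW) (by fun_prop))
  have hg : Measurable fun w : 𝒟 × 𝒞 × 𝒳 => ENNReal.ofReal (trueMass (f w.2.2) C m (J w)) :=
    (measurable_trueMass hf (by fun_prop) hJ).ennreal_ofReal
  rw [← lintegral_indicator hB, lintegral_prod _ (hg.indicator hB).aemeasurable,
    Measure.prod_apply hS]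
  refine lintegral_congr fun D => ?_
  rw [Measure.prod_apply (measurable_prodMk_left hS),
    lintegral_prod (fun y => B.indicator _ (D, y))
      ((hg.indicator hB).comp measurable_prodMk_left).aemeasurable]
  refine lintegral_congr fun c => ?_
  have hDc : Measurable fun x : 𝒳 => (D, c, x) := by fun_prop
  have h := measure_mem_toSet (m := m) hC hf hd hν (hJ.comp hDc) (fun x => hle (D, c, x)) (hDc hB)
  rw [← lintegral_indicator (hDc hB)] at h
  exact h

end Law

section CondExp

variable {Ω 𝒲 : Type*} [MeasurableSpace Ω] [MeasurableSpace 𝒲] {μ : Measure Ω}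
  [IsProbabilityMeasure μ]

/-- A bounded function of `W` with the correct integrals is the conditional probability of `A`
given `W`. -/
theorem condExp_indicator_ae_eq {W : Ω → 𝒲} (hW : Measurable W) {A : Set Ω} (hA : MeasurableSet A)
    {g : 𝒲 → ℝ} (hg : Measurable g) (hg01 : ∀ w, g w ∈ Set.Icc (0 : ℝ) 1)
    (h : ∀ B, MeasurableSet B →
      μ (W ⁻¹' B ∩ A) = ∫⁻ w in B, ENNReal.ofReal (g w) ∂(μ.map W)) :
    μ⟦A | MeasurableSpace.comap W inferInstance⟧ =ᵐ[μ] g ∘ W := by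
  have hint : Integrable (g ∘ W) μ :=
    Integrable.of_mem_Icc 0 1 (hg.comp hW).aemeasurable (ae_of_all _ fun ω => hg01 (W ω))
  refine (ae_eq_condExp_of_forall_setIntegral_eq hW.comap_le
    ((integrable_const (1 : ℝ)).indicator hA) (fun _ _ _ => hint.integrableOn) ?_ ?_).symm
  · rintro _ ⟨B, hB, rfl⟩ -
    rw [setIntegral_indicator hA, setIntegral_const, smul_eq_mul, mul_one, Measure.real, h B hB,
      setLIntegral_map hB hg.ennreal_ofReal hW]
    exact integral_eq_lintegral_of_nonneg_ae (ae_of_all _ fun ω => (hg01 (W ω)).1)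
      hint.aestronglyMeasurable.restrict
  · exact (hg.comp (comap_measurable W)).aestronglyMeasurable

end CondExp

/-! ### Concentration of empirical frequencies -/

section Hoeffding

variable {𝒵 : Type*}

open Classical in
/-- The number of sample points in the set `A`. -/
def count {n : ℕ} (A : Set 𝒵) (z : Fin n → 𝒵) : ℕ := (Finset.univ.filter fun i => z i ∈ A).card

theorem count_eq_sum {n : ℕ} (A : Set 𝒵) (z : Fin n → 𝒵) :
    (count A z : ℝ) = ∑ i, A.indicator (fun _ => (1 : ℝ)) (z i) := by
  classical
  simp [count, Set.indicator_apply]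

theorem count_compl {n : ℕ} (A : Set 𝒵) (z : Fin n → 𝒵) :
    (count Aᶜ z : ℝ) = n - count A z := by
  simp only [count_eq_sum, Set.indicator_compl, Pi.sub_apply, Finset.sum_sub_distrib]
  simp

variable [MeasurableSpace 𝒵] {ν : Measure 𝒵} [IsProbabilityMeasure ν] {A : Set 𝒵}

/-- Hoeffding's inequality for the upper tail of an empirical frequency. -/
theorem measure_le_count_le (hA : MeasurableSet A) (n : ℕ) {c : ℝ} (hc : 0 ≤ c) :
    (Measure.pi fun _ : Fin n => ν).real {z | n * (ν.real A + c) ≤ count A z} ≤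
      Real.exp (-2 * n * c ^ 2) := by
  rcases Nat.eq_zero_or_pos n with rfl | hn
  · simp
  set φ : 𝒵 → ℝ := A.indicator fun _ => (1 : ℝ) with hφ
  have hφm : Measurable φ := measurable_const.indicator hA
  have hφint : ∫ z, φ z ∂ν = ν.real A := by
    rw [hφ, integral_indicator hA]; simp
  have hsub : HasSubgaussianMGF (fun z => φ z - ν.real A) ((‖(1 : ℝ) - 0‖₊ / 2) ^ 2) ν := by
    rw [← hφint]
    refine hasSubgaussianMGF_of_mem_Icc hφm.aemeasurable (ae_of_all _ fun z => ?_)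
    by_cases hz : z ∈ A <;> simp [hφ, hz]
  have hindep : iIndepFun (fun (i : Fin n) (z : Fin n → 𝒵) => φ (z i) - ν.real A)
      (Measure.pi fun _ : Fin n => ν) :=
    iIndepFun_pi (X := fun _ z => φ z - ν.real A) fun _ => (hφm.sub_const _).aemeasurable
  have hsub' : ∀ i : Fin n, HasSubgaussianMGF (fun z : Fin n → 𝒵 => φ (z i) - ν.real A)
      ((‖(1 : ℝ) - 0‖₊ / 2) ^ 2) (Measure.pi fun _ : Fin n => ν) := by
    intro i
    have hmap := (measurePreserving_eval (fun _ : Fin n => ν) i).map_eq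
    refine HasSubgaussianMGF.of_map (X := fun z => φ z - ν.real A)
      (Y := fun z : Fin n → 𝒵 => z i) (measurable_pi_apply i).aemeasurable ?_
    have : (Measure.pi fun _ : Fin n => ν).map (fun z => z i) = ν := hmap
    rw [this]
    exact hsub
  have h := HasSubgaussianMGF.measure_sum_ge_le_of_iIndepFun hindep (s := Finset.univ)
    (fun i _ => hsub' i) (show 0 ≤ n * c by positivity)
  have hset : {z : Fin n → 𝒵 | n * (ν.real A + c) ≤ count A z} =
      {z | n * c ≤ ∑ i, (φ (z i) - ν.real A)} := by
    ext z
    simp only [Set.mem_ofPred_eq, count_eq_sum, Finset.sum_sub_distrib, Finset.sum_const,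
      Finset.card_univ, Fintype.card_fin, nsmul_eq_mul]
    rw [mul_add, le_sub_iff_add_le, add_comm]
  rw [hset]
  refine h.trans_eq ?_
  congr 1
  have hn' : (n : ℝ) ≠ 0 := by positivity
  simp
  field_simp

/-- Hoeffding's inequality for the lower tail of an empirical frequency. -/
theorem measure_count_le_le (hA : MeasurableSet A) (n : ℕ) {c : ℝ} (hc : 0 ≤ c) :
    (Measure.pi fun _ : Fin n => ν).real {z | count A z ≤ n * (ν.real A - c)} ≤
      Real.exp (-2 * n * c ^ 2) := by
  refine le_trans (le_of_eq ?_) (measure_le_count_le (ν := ν) hA.compl n hc)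
  congr 1
  ext z
  simp only [Set.mem_ofPred_eq, count_compl, probReal_compl_eq_one_sub hA]
  constructor <;> intro h <;> linarith

end Hoeffding

/-! ### The joint law of the three samples -/

section Samples

variable {Ω 𝒵 : Type*} [MeasurableSpace Ω] [MeasurableSpace 𝒵] {μ : Measure Ω}
  [IsProbabilityMeasure μ] {Z : ℕ → Ω → 𝒵}

theorem map_block_eq_pi (hZ : ∀ i, Measurable (Z i)) (hindep : iIndepFun Z μ)
    (hident : ∀ i, IdentDistrib (Z i) (Z 0) μ μ) (n a : ℕ) :
    μ.map (fun ω (i : Fin n) => Z (a + i) ω) = Measure.pi fun _ : Fin n => μ.map (Z 0) := by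
  have hinj : Function.Injective fun i : Fin n => a + (i : ℕ) := fun i j h => by
    ext; simpa using h
  have h := (iIndepFun_iff_map_fun_eq_pi_map (fun i => (hZ _).aemeasurable)).1
    (hindep.precomp hinj)
  refine h.trans ?_
  congr 1
  funext i
  exact (hident _).map_eq

theorem map_samples_eq_prod (hZ : ∀ i, Measurable (Z i)) (hindep : iIndepFun Z μ)
    (hident : ∀ i, IdentDistrib (Z i) (Z 0) μ μ) (n : ℕ) :
    μ.map (fun ω => ((fun i : Fin n => Z i ω), (fun i : Fin n => Z (n + i) ω), Z (2 * n) ω)) =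
      (Measure.pi fun _ : Fin n => μ.map (Z 0)).prod
        ((Measure.pi fun _ : Fin n => μ.map (Z 0)).prod (μ.map (Z 0))) := by
  have hm1 : Measurable fun ω (i : Fin n) => Z i ω := measurable_pi_lambda _ fun i => hZ _
  have hm2 : Measurable fun ω (i : Fin n) => Z (n + i) ω := measurable_pi_lambda _ fun i => hZ _
  have hi1 : IndepFun (fun ω (i : Fin n) => Z i ω)
      (fun ω => ((fun i : Fin n => Z (n + i) ω), Z (2 * n) ω)) μ := by
    have h := hindep.indepFun_finset (Finset.range n) (Finset.Ico n (2 * n + 1))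
      (by rw [Finset.disjoint_left]; intro i; simp; omega) hZ
    exact h.comp
      (φ := fun (v : Finset.range n → 𝒵) (i : Fin n) => v ⟨i, by simp⟩)
      (ψ := fun (v : Finset.Ico n (2 * n + 1) → 𝒵) =>
        ((fun i : Fin n => v ⟨n + i, by simp; omega⟩), v ⟨2 * n, by simp; omega⟩))
      (by fun_prop) (by fun_prop)
  have hi2 : IndepFun (fun ω (i : Fin n) => Z (n + i) ω) (Z (2 * n)) μ := by
    have h := hindep.indepFun_finset (Finset.Ico n (2 * n)) {2 * n} (by simp) hZ
    exact h.comp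
      (φ := fun (v : Finset.Ico n (2 * n) → 𝒵) (i : Fin n) => v ⟨n + i, by simp; omega⟩)
      (ψ := fun (v : ({2 * n} : Finset ℕ) → 𝒵) => v ⟨2 * n, by simp⟩)
      (by fun_prop) (by fun_prop)
  rw [hi1.map_prod_eq_prod_map_map hm1.aemeasurable (hm2.prodMk (hZ _)).aemeasurable,
    hi2.map_prod_eq_prod_map_map hm2.aemeasurable (hZ _).aemeasurable,
    map_block_eq_pi hZ hindep hident, (hident (2 * n)).map_eq]
  congr 1
  simpa using map_block_eq_pi hZ hindep hident n 0

end Samples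

/-! ### Sets with small sections -/

/-- A set all of whose sections are small is small. -/
theorem measureReal_prod_le {α β : Type*} [MeasurableSpace α] [MeasurableSpace β] {μ : Measure α}
    {ν : Measure β} [IsProbabilityMeasure μ] [IsProbabilityMeasure ν] {E : Set (α × β)}
    (hE : MeasurableSet E) {b : ℝ} (hb : 0 ≤ b) (h : ∀ a, ν.real {y | (a, y) ∈ E} ≤ b) :
    (μ.prod ν).real E ≤ b := by
  refine ENNReal.toReal_le_of_le_ofReal hb ?_
  rw [Measure.prod_apply hE]
  calc ∫⁻ a, ν (Prod.mk a ⁻¹' E) ∂μ ≤ ∫⁻ _, ENNReal.ofReal b ∂μ :=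
        lintegral_mono fun a => (ENNReal.le_ofReal_iff_toReal_le (measure_ne_top _ _) hb).2 (h a)
    _ = ENNReal.ofReal b := by simp

/-- Union bound for the first coordinate and its pairings with the second and the third one. -/
theorem measureReal_good_le {𝒟 𝒞 𝒱 : Type*} [MeasurableSpace 𝒟] [MeasurableSpace 𝒞]
    [MeasurableSpace 𝒱] {P : Measure 𝒟} {Q : Measure 𝒞} {V : Measure 𝒱} [IsProbabilityMeasure P]
    [IsProbabilityMeasure Q] [IsProbabilityMeasure V] {G : Set 𝒟} {B : Set (𝒟 × 𝒞)}
    {A : Set (𝒟 × 𝒱)} {a b c : ℝ} (hG : MeasurableSet G) (hGa : P.real Gᶜ ≤ a)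
    (hB : MeasurableSet B) (hb : 0 ≤ b) (hBb : ∀ D, Q.real {c | (D, c) ∈ B} ≤ b)
    (hA : MeasurableSet A) (hc : 0 ≤ c) (hAc : ∀ D ∈ G, V.real {x | (D, x) ∈ A} ≤ c) :
    1 - (a + c + b) ≤ (P.prod (Q.prod V)).real
      {w | w.1 ∈ G ∧ (w.1, w.2.1) ∉ B ∧ (w.1, w.2.2) ∉ A} := by
  have hw₂ : Measurable fun w : 𝒟 × 𝒞 × 𝒱 => (w.1, w.2.1) := by fun_prop
  have hw₃ : Measurable fun w : 𝒟 × 𝒞 × 𝒱 => (w.1, w.2.2) := by fun_prop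
  have hEm : MeasurableSet {w : 𝒟 × 𝒞 × 𝒱 | w.1 ∈ G ∧ (w.1, w.2.1) ∉ B ∧ (w.1, w.2.2) ∉ A} :=
    (measurable_fst hG).inter ((hw₂ hB).compl.inter (hw₃ hA).compl)
  set E := {w : 𝒟 × 𝒞 × 𝒱 | w.1 ∈ G ∧ (w.1, w.2.1) ∉ B ∧ (w.1, w.2.2) ∉ A}
  have hcompl : Eᶜ ⊆ Gᶜ ×ˢ Set.univ ∪ {w | w.1 ∈ G ∧ (w.1, w.2.2) ∈ A} ∪
      {w | (w.1, w.2.1) ∈ B} := by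
    intro w hw
    by_cases h1 : w.1 ∈ G
    · by_cases h3 : (w.1, w.2.1) ∈ B
      · exact Or.inr h3
      · exact Or.inl (Or.inr ⟨h1, by_contra fun h2 => hw ⟨h1, h3, h2⟩⟩)
    · exact Or.inl (Or.inl ⟨h1, Set.mem_univ _⟩)
  have h1 : (P.prod (Q.prod V)).real (Gᶜ ×ˢ Set.univ) ≤ a := by
    rwa [measureReal_prod_prod, probReal_univ, mul_one]
  have h2 : (P.prod (Q.prod V)).real {w | w.1 ∈ G ∧ (w.1, w.2.2) ∈ A} ≤ c := by
    refine measureReal_prod_le (E := {w : 𝒟 × 𝒞 × 𝒱 | w.1 ∈ G ∧ (w.1, w.2.2) ∈ A})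
      ((measurable_fst hG).inter (hw₃ hA)) hc fun D => ?_
    by_cases hD : D ∈ G
    · have : {y : 𝒞 × 𝒱 | (D, y) ∈ {w : 𝒟 × 𝒞 × 𝒱 | w.1 ∈ G ∧ (w.1, w.2.2) ∈ A}} =
          Set.univ ×ˢ {x | (D, x) ∈ A} := by
        ext y; simp [hD]
      rw [this, measureReal_prod_prod, probReal_univ, one_mul]
      exact hAc D hD
    · have : {y : 𝒞 × 𝒱 | (D, y) ∈ {w : 𝒟 × 𝒞 × 𝒱 | w.1 ∈ G ∧ (w.1, w.2.2) ∈ A}} = ∅ := by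
        ext y; simp [hD]
      rwa [this, measureReal_empty]
  have h3 : (P.prod (Q.prod V)).real {w | (w.1, w.2.1) ∈ B} ≤ b := by
    refine measureReal_prod_le (E := {w : 𝒟 × 𝒞 × 𝒱 | (w.1, w.2.1) ∈ B}) (hw₂ hB) hb fun D => ?_
    have : {y : 𝒞 × 𝒱 | (D, y) ∈ {w : 𝒟 × 𝒞 × 𝒱 | (w.1, w.2.1) ∈ B}} =
        {c | (D, c) ∈ B} ×ˢ Set.univ := by
      ext y; simp
    rw [this, measureReal_prod_prod, probReal_univ, mul_one]
    exact hBb D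
  have h4 : (P.prod (Q.prod V)).real Eᶜ ≤ a + c + b :=
    calc _ ≤ _ := measureReal_mono hcompl (measure_ne_top _ _)
      _ ≤ _ := measureReal_union_le _ _
      _ ≤ _ := add_le_add ((measureReal_union_le _ _).trans (add_le_add h1 h2)) h3
  rw [probReal_compl_eq_one_sub hEm] at h4
  linarith

/-! ### The calibrated level at a fixed sample size -/

section Fixed

variable {𝒳 : Type*} [MeasurableSpace 𝒳]

/-- The calibrated index `t̂` of the nested sequence, for the fitted histogram `h`. -/
def calIndex {n : ℕ} (C α : ℝ) (ρ : Finset (ℕ × ℕ) → ℕ × ℕ) (m T t₀ : ℕ) (h : 𝒳 → ℕ → ℝ)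
    (cal : Fin n → 𝒳 × ℝ) : ℕ :=
  kthSmallest T ⌈(1 - α) * (n + 1)⌉₊
    fun i => score C m T (nested ρ m T t₀ (h (cal i).1)) (cal i).2

omit [MeasurableSpace 𝒳] in
theorem calIndex_le {n : ℕ} (C α : ℝ) (ρ : Finset (ℕ × ℕ) → ℕ × ℕ) (m T t₀ : ℕ) (h : 𝒳 → ℕ → ℝ)
    (cal : Fin n → 𝒳 × ℝ) : calIndex C α ρ m T t₀ h cal ≤ T :=
  kthSmallest_le fun _ => score_le

/-- The pairs `(x, y)` such that `y` lies in the interval `S_t` at `x`. -/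
def hitSet (C : ℝ) (ρ : Finset (ℕ × ℕ) → ℕ × ℕ) (m T t₀ : ℕ) (h : 𝒳 → ℕ → ℝ) (t : ℕ) :
    Set (𝒳 × ℝ) :=
  {q | q.2 ∈ toSet C m (nested ρ m T t₀ (h q.1) t)}

/-- The training samples for which the estimated distribution function has a mean squared error of
at most `η ^ 2` at every bin edge. -/
def goodTrain {n : ℕ} (ν : Measure (𝒳 × ℝ)) (f : 𝒳 → ℝ → ℝ) (C η : ℝ) (m : ℕ)
    (h : (Fin n → 𝒳 × ℝ) → 𝒳 → ℕ → ℝ) : Set (Fin n → 𝒳 × ℝ) :=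
  {D | ∀ j ∈ Finset.Icc 1 m,
    ∫ x, (∑ i ∈ Finset.Icc 1 j, h D x i - cdfOf (f x) (edge C m j)) ^ 2 ∂ν.fst ≤ η ^ 2}

/-- The standing assumptions at the sample size `n`: `ν` is the law of one observation, `f` its
conditional density, `h` the estimator with bin parameter `η` and `m` bins. The rate of the
estimator is expressed through the cube root `s` of `η`. -/
structure Setting (ν : Measure (𝒳 × ℝ)) (f : 𝒳 → ℝ → ℝ) (C K α η s : ℝ) (n m t₀ : ℕ)
    (h : (Fin n → 𝒳 × ℝ) → 𝒳 → ℕ → ℝ) (ρ : Finset (ℕ × ℕ) → ℕ × ℕ) : Prop where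
  C_pos : 0 < C
  K_pos : 0 < K
  α_pos : 0 < α
  α_le_one : α ≤ 1
  one_le_n : 1 ≤ n
  η_pos : 0 < η
  η_le_one : η ≤ 1
  s_pos : 0 < s
  s_pow : s ^ 3 = η
  m_eq : m = ⌊η⁻¹⌋₊
  measurable_density : Measurable (Function.uncurry f)
  isDensityOn : ∀ x, IsDensityOn C K (f x)
  law : ν = (ν.fst.prod volume).withDensity fun q => ENNReal.ofReal (f q.1 q.2)
  measurable_hist : ∀ j, Measurable fun q : (Fin n → 𝒳 × ℝ) × 𝒳 => h q.1 q.2 j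
  isHistogram : ∀ D x, IsHistogram m (h D x)
  hist_le : ∀ D x, ∀ j ∈ Finset.Icc 1 m, h D x j ≤ K * η
  consistent : ∀ j ∈ Finset.Icc 1 m, 1 - η ^ 2 ≤ (Measure.pi fun _ : Fin n => ν).real
    {D | ∫ x, (∑ i ∈ Finset.Icc 1 j, h D x i - cdfOf (f x) (edge C m j)) ^ 2 ∂ν.fst ≤ η ^ 2}
  rule_mem : ∀ A : Finset (ℕ × ℕ), A.Nonempty → ρ A ∈ A
  start_le : t₀ ≤ n
  start_level : |level n t₀ - (1 - α)| ≤ 1 / n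

namespace Setting

variable {ν : Measure (𝒳 × ℝ)} {f : 𝒳 → ℝ → ℝ} {C K α η s : ℝ} {n m t₀ : ℕ}
  {h : (Fin n → 𝒳 × ℝ) → 𝒳 → ℕ → ℝ} {ρ : Finset (ℕ × ℕ) → ℕ × ℕ}
  (H : Setting ν f C K α η s n m t₀ h ρ)
include H

theorem one_le_m : 1 ≤ m := by
  rw [H.m_eq]
  exact Nat.le_floor (by simpa using (one_le_inv₀ H.η_pos).2 H.η_le_one)

theorem m_mul_le : m * η ≤ 1 := by
  have h1 : (m : ℝ) ≤ η⁻¹ := by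
    rw [H.m_eq]; exact Nat.floor_le (inv_nonneg.2 H.η_pos.le)
  calc m * η ≤ η⁻¹ * η := by gcongr; exact H.η_pos.le
    _ = 1 := inv_mul_cancel₀ H.η_pos.ne'

theorem one_div_m_le : 1 / (m : ℝ) ≤ 2 * η := by
  have h0 : (1 : ℝ) ≤ m := by exact_mod_cast H.one_le_m
  have h1 : η⁻¹ ≤ m + 1 := by rw [H.m_eq]; exact (Nat.lt_floor_add_one _).le
  have h2 : η⁻¹ ≤ 2 * m := by linarith
  have h3 : 1 ≤ 2 * m * η := by
    calc 1 = η⁻¹ * η := (inv_mul_cancel₀ H.η_pos.ne').symm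
      _ ≤ _ := by gcongr; exact H.η_pos.le
  rw [div_le_iff₀ (by linarith)]
  linarith

theorem s_le_one : s ≤ 1 := by
  have : s ^ 3 ≤ 1 := H.s_pow.trans_le H.η_le_one
  exact (pow_le_one_iff_of_nonneg H.s_pos.le (by norm_num)).1 this

theorem isTight (D : Fin n → 𝒳 × ℝ) (x : 𝒳) {t : ℕ} (ht : t ≤ n) :
    IsTight m (h D x) (K * η) (level n t) (nested ρ m n t₀ (h D x) t) :=
  isTight_nested H.rule_mem H.one_le_m (H.isHistogram D x) (H.hist_le D x) H.start_le ht

theorem nested_le (D : Fin n → 𝒳 × ℝ) (x : 𝒳) {t : ℕ} (ht : t ≤ n) :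
    (nested ρ m n t₀ (h D x) t).1 ≤ (nested ρ m n t₀ (h D x) t).2 := (H.isTight D x ht).le

theorem abs_mass_sub_le (D : Fin n → 𝒳 × ℝ) (x : 𝒳) {t : ℕ} (ht : t ≤ n) :
    |mass (h D x) (nested ρ m n t₀ (h D x) t) -
      trueMass (f x) C m (nested ρ m n t₀ (h D x) t)| ≤ s + sqErr C m (h D x) (f x) / (2 * s) :=
  (H.isDensityOn x).abs_mass_sub_trueMass_le H.s_pos (H.isTight D x ht).one_le
    (H.isTight D x ht).le (H.isTight D x ht).le_bins

/-! ### Errors of the estimated distribution functions -/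

theorem measurable_err (j : ℕ) : Measurable fun q : (Fin n → 𝒳 × ℝ) × 𝒳 =>
    (∑ i ∈ Finset.Icc 1 j, h q.1 q.2 i - cdfOf (f q.2) (edge C m j)) ^ 2 :=
  ((Finset.measurable_fun_sum _ fun i _ => H.measurable_hist i).sub
    ((measurable_cdfOf H.measurable_density _).comp measurable_snd)).pow_const 2

theorem measurable_sqErr :
    Measurable fun q : (Fin n → 𝒳 × ℝ) × 𝒳 => sqErr C m (h q.1 q.2) (f q.2) :=
  Finset.measurable_fun_sum _ fun j _ => H.measurable_err j

theorem err_mem_Icc (D : Fin n → 𝒳 × ℝ) (x : 𝒳) {j : ℕ} (hj : j ∈ Finset.Icc 1 m) :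
    (∑ i ∈ Finset.Icc 1 j, h D x i - cdfOf (f x) (edge C m j)) ^ 2 ∈ Set.Icc (0 : ℝ) 1 := by
  have hj' := Finset.mem_Icc.1 hj
  have h0 : 0 ≤ ∑ i ∈ Finset.Icc 1 j, h D x i := Finset.sum_nonneg fun i hi =>
    (H.isHistogram D x).1 i (Finset.Icc_subset_Icc_right hj'.2 hi)
  have h1 : ∑ i ∈ Finset.Icc 1 j, h D x i ≤ 1 := by
    rw [← (H.isHistogram D x).2]
    exact Finset.sum_le_sum_of_subset_of_nonneg (Finset.Icc_subset_Icc_right hj'.2)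
      fun i hi _ => (H.isHistogram D x).1 i hi
  have h2 := (H.isDensityOn x).cdfOf_nonneg (edge C m j)
  have h3 := (H.isDensityOn x).cdfOf_le_one (edge C m j)
  exact ⟨sq_nonneg _, (sq_le_one_iff_abs_le_one _).2 (abs_le.2 ⟨by linarith, by linarith⟩)⟩

theorem sqErr_mem_Icc (D : Fin n → 𝒳 × ℝ) (x : 𝒳) :
    sqErr C m (h D x) (f x) ∈ Set.Icc (0 : ℝ) m := by
  refine ⟨sqErr_nonneg _ _ _ _, ?_⟩
  calc sqErr C m (h D x) (f x) ≤ ∑ j ∈ Finset.Icc 1 m, (1 : ℝ) :=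
        Finset.sum_le_sum fun j hj => (H.err_mem_Icc D x hj).2
    _ = m := by simp

variable [IsProbabilityMeasure ν]

theorem measurableSet_mse_le (j : ℕ) : MeasurableSet {D : Fin n → 𝒳 × ℝ |
    ∫ x, (∑ i ∈ Finset.Icc 1 j, h D x i - cdfOf (f x) (edge C m j)) ^ 2 ∂ν.fst ≤ η ^ 2} :=
  measurableSet_le
    ((H.measurable_err j).stronglyMeasurable.integral_prod_right (ν := ν.fst)).measurable
    measurable_const

theorem measurableSet_goodTrain : MeasurableSet (goodTrain ν f C η m h) := by
  have : goodTrain ν f C η m h = ⋂ j ∈ Finset.Icc 1 m, {D : Fin n → 𝒳 × ℝ |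
      ∫ x, (∑ i ∈ Finset.Icc 1 j, h D x i - cdfOf (f x) (edge C m j)) ^ 2 ∂ν.fst ≤ η ^ 2} := by
    ext D; simp [goodTrain]
  rw [this]
  exact Finset.measurableSet_biInter _ fun j _ => H.measurableSet_mse_le j

/-- A union bound over the `m ≤ 1 / η` bin edges. -/
theorem measure_goodTrain_compl_le :
    (Measure.pi fun _ : Fin n => ν).real (goodTrain ν f C η m h)ᶜ ≤ η := by
  have hsub : (goodTrain ν f C η m h)ᶜ ⊆ ⋃ j ∈ Finset.Icc 1 m, {D : Fin n → 𝒳 × ℝ |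
      ∫ x, (∑ i ∈ Finset.Icc 1 j, h D x i - cdfOf (f x) (edge C m j)) ^ 2 ∂ν.fst ≤ η ^ 2}ᶜ := by
    intro D hD
    simpa [goodTrain, and_assoc] using hD
  calc _ ≤ _ := measureReal_mono hsub (measure_ne_top _ _)
    _ ≤ _ := measureReal_biUnion_finset_le _ _
    _ ≤ ∑ j ∈ Finset.Icc 1 m, η ^ 2 := by
      refine Finset.sum_le_sum fun j hj => ?_
      rw [probReal_compl_eq_one_sub (H.measurableSet_mse_le j)]
      linarith [H.consistent j hj]
    _ = (m * η) * η := by simp; ring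
    _ ≤ 1 * η := by gcongr; exacts [H.η_pos.le, H.m_mul_le]
    _ = η := one_mul η

theorem integrable_sqErr (D : Fin n → 𝒳 × ℝ) :
    Integrable (fun x => sqErr C m (h D x) (f x)) ν.fst :=
  Integrable.of_mem_Icc 0 m (H.measurable_sqErr.comp measurable_prodMk_left).aemeasurable
    (ae_of_all _ fun x => H.sqErr_mem_Icc D x)

theorem integral_sqErr_le {D : Fin n → 𝒳 × ℝ} (hD : D ∈ goodTrain ν f C η m h) :
    ∫ x, sqErr C m (h D x) (f x) ∂ν.fst ≤ s ^ 3 := by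
  unfold sqErr
  have hint : ∀ j ∈ Finset.Icc 1 m, Integrable (fun x =>
      (∑ i ∈ Finset.Icc 1 j, h D x i - cdfOf (f x) (edge C m j)) ^ 2) ν.fst := fun j hj =>
    Integrable.of_mem_Icc 0 1 ((H.measurable_err j).comp measurable_prodMk_left).aemeasurable
      (ae_of_all _ fun x => H.err_mem_Icc D x hj)
  rw [integral_finsetSum _ hint]
  calc _ ≤ ∑ j ∈ Finset.Icc 1 m, η ^ 2 := Finset.sum_le_sum hD
    _ = (m * η) * η := by simp; ring
    _ ≤ 1 * η := by gcongr; exacts [H.η_pos.le, H.m_mul_le]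
    _ = s ^ 3 := by rw [one_mul, H.s_pow]

/-- Chebyshev's inequality at a new feature vector. -/
theorem measure_sq_le_sqErr_le {D : Fin n → 𝒳 × ℝ} (hD : D ∈ goodTrain ν f C η m h) :
    ν.fst.real {x | s ^ 2 ≤ sqErr C m (h D x) (f x)} ≤ s := by
  have h1 := mul_meas_ge_le_integral_of_nonneg
    (ae_of_all _ fun x => (H.sqErr_mem_Icc D x).1) (H.integrable_sqErr D) (s ^ 2)
  have h2 := h1.trans (H.integral_sqErr_le hD)
  have hs : 0 < s ^ 2 := pow_pos H.s_pos 2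
  refine le_of_mul_le_mul_left (h2.trans_eq ?_) hs
  ring

/-! ### Empirical and theoretical coverage of the intervals `S_t` -/

omit [IsProbabilityMeasure ν] in
theorem measurableSet_hitSet_prod (t : ℕ) : MeasurableSet {z : (Fin n → 𝒳 × ℝ) × (𝒳 × ℝ) |
    z.2 ∈ hitSet C ρ m n t₀ (h z.1) t} := by
  refine measurableSet_mem_toSet C m
    (measurable_nested (π := fun z : (Fin n → 𝒳 × ℝ) × (𝒳 × ℝ) => h z.1 z.2.1) (fun j => ?_)
      ρ m n t₀ measurable_const) (by fun_prop)
  exact (H.measurable_hist j).comp (by fun_prop : Measurable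
    fun z : (Fin n → 𝒳 × ℝ) × (𝒳 × ℝ) => (z.1, z.2.1))

omit [IsProbabilityMeasure ν] in
theorem measurableSet_hitSet (D : Fin n → 𝒳 × ℝ) (t : ℕ) :
    MeasurableSet (hitSet C ρ m n t₀ (h D) t) :=
  measurable_prodMk_left (H.measurableSet_hitSet_prod t)

omit [IsProbabilityMeasure ν] in
theorem measurable_nested_apply (D : Fin n → 𝒳 × ℝ) (t : ℕ) :
    Measurable fun x => nested ρ m n t₀ (h D x) t :=
  measurable_nested (fun j => (H.measurable_hist j).comp measurable_prodMk_left) ρ m n t₀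
    measurable_const

omit [IsProbabilityMeasure ν] in
theorem trueMass_mem_Icc (D : Fin n → 𝒳 × ℝ) (x : 𝒳) {t : ℕ} (ht : t ≤ n) :
    trueMass (f x) C m (nested ρ m n t₀ (h D x) t) ∈ Set.Icc (0 : ℝ) 1 :=
  (H.isDensityOn x).trueMass_mem_Icc H.C_pos.le (H.nested_le D x ht)

theorem measure_hitSet (D : Fin n → 𝒳 × ℝ) {t : ℕ} (ht : t ≤ n) :
    ν.real (hitSet C ρ m n t₀ (h D) t) =
      ∫ x, trueMass (f x) C m (nested ρ m n t₀ (h D x) t) ∂ν.fst := by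
  have h1 := measure_mem_toSet (m := m) H.C_pos.le H.measurable_density H.isDensityOn H.law
    (H.measurable_nested_apply D t) (fun x => H.nested_le D x ht) MeasurableSet.univ
  simp only [Set.mem_univ, true_and, Measure.restrict_univ] at h1
  rw [integral_eq_lintegral_of_nonneg_ae (ae_of_all _ fun x => (H.trueMass_mem_Icc D x ht).1)
    (measurable_trueMass H.measurable_density measurable_id
      (H.measurable_nested_apply D t)).aestronglyMeasurable]
  exact congrArg ENNReal.toReal h1

theorem integrable_trueMass (D : Fin n → 𝒳 × ℝ) {t : ℕ} (ht : t ≤ n) :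
    Integrable (fun x => trueMass (f x) C m (nested ρ m n t₀ (h D x) t)) ν.fst :=
  Integrable.of_mem_Icc 0 1 (measurable_trueMass H.measurable_density measurable_id
    (H.measurable_nested_apply D t)).aemeasurable (ae_of_all _ fun x => H.trueMass_mem_Icc D x ht)

theorem integral_bound_le {D : Fin n → 𝒳 × ℝ} (hD : D ∈ goodTrain ν f C η m h) :
    ∫ x, (s + sqErr C m (h D x) (f x) / (2 * s)) ∂ν.fst ≤ 3 / 2 * s := by
  rw [integral_add (integrable_const _) ((H.integrable_sqErr D).div_const _), integral_div]
  have hs := H.s_pos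
  have h1 : (∫ x, sqErr C m (h D x) (f x) ∂ν.fst) / (2 * s) ≤ s ^ 3 / (2 * s) := by
    gcongr
    exact H.integral_sqErr_le hD
  have h2 : s ^ 3 / (2 * s) = s * s / 2 := by field_simp
  have h3 : s * s ≤ s * 1 := by gcongr; exact H.s_le_one
  simp only [integral_const, probReal_univ, smul_eq_mul, one_mul]
  linarith

theorem level_sub_le_measure_hitSet {D : Fin n → 𝒳 × ℝ} (hD : D ∈ goodTrain ν f C η m h) {t : ℕ}
    (ht : t ≤ n) : level n t - 3 / 2 * s ≤ ν.real (hitSet C ρ m n t₀ (h D) t) := by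
  rw [H.measure_hitSet D ht]
  have hint : Integrable (fun x => s + sqErr C m (h D x) (f x) / (2 * s)) ν.fst :=
    (integrable_const s).add ((H.integrable_sqErr D).div_const (2 * s))
  calc level n t - 3 / 2 * s
      ≤ ∫ x, (level n t - (s + sqErr C m (h D x) (f x) / (2 * s))) ∂ν.fst := by
        rw [integral_sub (integrable_const _) hint]
        simp only [integral_const, probReal_univ, smul_eq_mul, one_mul]
        linarith [H.integral_bound_le hD]
    _ ≤ _ := by
        refine integral_mono ((integrable_const _).sub hint) (H.integrable_trueMass D ht)
          fun x => ?_
        have h1 := abs_le.1 (H.abs_mass_sub_le D x ht)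
        have h2 := (H.isTight D x ht).le_mass
        dsimp only
        linarith

theorem measure_hitSet_le {D : Fin n → 𝒳 × ℝ} (hD : D ∈ goodTrain ν f C η m h) {t : ℕ}
    (ht : t ≤ n) :
    ν.real (hitSet C ρ m n t₀ (h D) t) ≤ level n t + K * η + 3 / 2 * s := by
  rw [H.measure_hitSet D ht]
  have hint : Integrable (fun x => s + sqErr C m (h D x) (f x) / (2 * s)) ν.fst :=
    (integrable_const s).add ((H.integrable_sqErr D).div_const (2 * s))
  calc _ ≤ ∫ x, (level n t + K * η + (s + sqErr C m (h D x) (f x) / (2 * s))) ∂ν.fst := by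
        refine integral_mono (H.integrable_trueMass D ht) ((integrable_const _).add hint)
          fun x => ?_
        have h1 := abs_le.1 (H.abs_mass_sub_le D x ht)
        have h2 := (H.isTight D x ht).mass_le
        dsimp only
        linarith
    _ ≤ _ := by
        rw [integral_add (integrable_const _) hint]
        simp only [integral_const, probReal_univ, smul_eq_mul, one_mul]
        linarith [H.integral_bound_le hD]

omit [IsProbabilityMeasure ν] in
open Classical in
theorem card_score_le (D c : Fin n → 𝒳 × ℝ) {t : ℕ} (ht : t < n) :
    (Finset.univ.filter fun i => score C m n (nested ρ m n t₀ (h D (c i).1)) (c i).2 ≤ t).card =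
      count (hitSet C ρ m n t₀ (h D) t) c := by
  unfold count
  congr 1
  ext i
  simp only [Finset.mem_filter, Finset.mem_univ, true_and]
  exact score_le_iff ht fun a b hab hb => toSet_subset H.C_pos.le
    (H.nested_le D _ (hab.trans hb)) (bins_nested_mono H.rule_mem H.one_le_m
      (H.isHistogram D _) (H.hist_le D _) H.start_le hab hb)

/-- If the empirical coverage of `S_t` is not much above its probability, for the last `t` with
`t / n < θ`, then fewer than `(1 - α) (n + 1)` scores are at most `t`. -/
theorem le_level_calIndex {D c : Fin n → 𝒳 × ℝ} (hD : D ∈ goodTrain ν f C η m h) {a θ : ℝ}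
    (hθ : θ = 1 - α - 3 / 2 * s - K * η - a)
    (hc : (count (hitSet C ρ m n t₀ (h D) (⌈n * θ⌉₊ - 1)) c : ℝ) <
      n * (ν.real (hitSet C ρ m n t₀ (h D) (⌈n * θ⌉₊ - 1)) + a)) (ha : 0 ≤ a) :
    θ ≤ level n (calIndex C α ρ m n t₀ (h D) c) := by
  have hn : (0 : ℝ) < n := by exact_mod_cast H.one_le_n
  rcases le_or_gt θ 0 with h0 | h0
  · exact h0.trans (level_nonneg _ _)
  -- `t` is the largest index with `t / n < θ`; the slack in `θ` absorbs the error of the estimator,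
  -- the excess mass of `S_t` and the sampling error `a`.
  set t := ⌈n * θ⌉₊ - 1 with ht
  have hpos : 0 < ⌈n * θ⌉₊ := Nat.ceil_pos.2 (by positivity)
  have htθ : (t : ℝ) < n * θ := Nat.lt_ceil.1 (by omega)
  have hKη : 0 < K * η := mul_pos H.K_pos H.η_pos
  have htn : t < n := by
    have : n * θ ≤ n * 1 := by
      gcongr
      linarith [H.s_pos, H.α_pos]
    exact_mod_cast htθ.trans_le (this.trans_eq (mul_one _))
  have hlevel : level n t < θ := by
    unfold level; rw [div_lt_iff₀ hn]; linarith
  have hp := H.measure_hitSet_le hD htn.le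
  have hlt : (count (hitSet C ρ m n t₀ (h D) t) c : ℝ) < (1 - α) * (n + 1) := by
    calc _ < _ := hc
      _ ≤ n * (1 - α) := by gcongr; linarith
      _ ≤ _ := by linarith [H.α_le_one]
  have hcard := H.card_score_le D c htn
  have hidx : t < calIndex C α ρ m n t₀ (h D) c := by
    refine lt_kthSmallest_of_card_lt (fun _ => score_le) htn (Nat.lt_ceil.2 ?_)
    exact lt_of_eq_of_lt (congrArg Nat.cast hcard) hlt
  have hceil : n * θ ≤ calIndex C α ρ m n t₀ (h D) c :=
    (Nat.le_ceil _).trans (by exact_mod_cast (by omega : ⌈n * θ⌉₊ ≤ _))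
  unfold level
  rw [le_div_iff₀ hn]
  linarith

/-- If the empirical coverage of `S_t` is not much below its probability, for a suitable `t`, then
at least `(1 - α) (n + 1)` scores are at most `t`. -/
theorem level_calIndex_le {D c : Fin n → 𝒳 × ℝ} (hD : D ∈ goodTrain ν f C η m h) {a θ : ℝ}
    (hθ : θ = 1 - α + 3 / 2 * s + a)
    (hc : n * (ν.real (hitSet C ρ m n t₀ (h D) ⌈n * θ + 1⌉₊) - a) <
      (count (hitSet C ρ m n t₀ (h D) ⌈n * θ + 1⌉₊) c : ℝ)) (ha : 0 ≤ a) :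
    level n (calIndex C α ρ m n t₀ (h D) c) ≤ θ + 2 / n := by
  have hn : (0 : ℝ) < n := by exact_mod_cast H.one_le_n
  -- The extra `1` makes up for the rank `(1 - α) (n + 1)`, which exceeds `(1 - α) n`.
  set t := ⌈n * θ + 1⌉₊ with ht
  have hθ0 : 0 ≤ θ := by linarith [H.s_pos, H.α_le_one]
  have htle : n * θ + 1 ≤ t := Nat.le_ceil _
  have htlt : (t : ℝ) ≤ n * θ + 2 := by
    have := Nat.ceil_lt_add_one (show 0 ≤ n * θ + 1 by positivity)
    linarith
  have hidx : calIndex C α ρ m n t₀ (h D) c ≤ t := by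
    rcases le_or_gt n t with hnt | htn
    · exact (calIndex_le C α ρ m n t₀ (h D) c).trans hnt
    have hlevel : θ + 1 / n ≤ level n t := by
      unfold level; rw [le_div_iff₀ hn]; field_simp; linarith
    have hp := H.level_sub_le_measure_hitSet hD htn.le
    have hle : (1 - α) * (n + 1) ≤ (count (hitSet C ρ m n t₀ (h D) t) c : ℝ) := by
      calc (1 - α) * (n + 1) ≤ n * (1 - α + 1 / n) := by
            rw [mul_add (n : ℝ), mul_one_div_cancel hn.ne']
            linarith [H.α_pos]
        _ ≤ n * (ν.real (hitSet C ρ m n t₀ (h D) t) - a) := by gcongr; linarith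
        _ ≤ _ := hc.le
    have hcard := H.card_score_le D c htn
    refine kthSmallest_le_of_le_card (Nat.ceil_le.2 ?_)
    exact hle.trans_eq (congrArg Nat.cast hcard.symm)
  calc level n (calIndex C α ρ m n t₀ (h D) c) ≤ level n t := level_mono n hidx
    _ ≤ _ := by
      unfold level
      rw [div_le_iff₀ hn, add_mul, div_mul_cancel₀ _ hn.ne']
      linarith

end Setting

end Fixed

section Fixed

variable {𝒳 : Type*} [MeasurableSpace 𝒳]

namespace Setting

variable {ν : Measure (𝒳 × ℝ)} {f : 𝒳 → ℝ → ℝ} {C K α η s : ℝ} {n m t₀ : ℕ}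
  {h : (Fin n → 𝒳 × ℝ) → 𝒳 → ℕ → ℝ} {ρ : Finset (ℕ × ℕ) → ℕ × ℕ}
  (H : Setting ν f C K α η s n m t₀ h ρ)
include H

/-! ### Probability of the exceptional samples -/

theorem exp_hoeffding : Real.exp (-2 * n * √(Real.log n / n) ^ 2) = 1 / (n : ℝ) ^ 2 := by
  have hn : (0 : ℝ) < n := by exact_mod_cast H.one_le_n
  have hlog : 0 ≤ Real.log n := Real.log_natCast_nonneg n
  rw [Real.sq_sqrt (by positivity)]
  have : -2 * n * (Real.log n / n) = -(2 * Real.log n) := by field_simp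
  rw [this, Real.exp_neg, two_mul, Real.exp_add, Real.exp_log hn, one_div, sq]

theorem measurable_count (t : ℕ) : Measurable fun z : (Fin n → 𝒳 × ℝ) × (Fin n → 𝒳 × ℝ) =>
    (count (hitSet C ρ m n t₀ (h z.1) t) z.2 : ℝ) := by
  simp only [count_eq_sum]
  refine Finset.measurable_fun_sum _ fun i _ => ?_
  have hz : Measurable fun z : (Fin n → 𝒳 × ℝ) × (Fin n → 𝒳 × ℝ) => (z.1, z.2 i) := by fun_prop
  exact (measurable_const (a := (1 : ℝ))).indicator (hz (H.measurableSet_hitSet_prod t))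

theorem measurable_predict {𝒵 : Type*} [MeasurableSpace 𝒵] {D c : 𝒵 → Fin n → 𝒳 × ℝ} {x : 𝒵 → 𝒳}
    (hD : Measurable D) (hc : Measurable c) (hx : Measurable x) :
    Measurable fun z => predict C α ρ m n t₀ (h (D z)) (c z) (x z) := by
  have hci : ∀ i, Measurable fun z => c z i := fun i => (measurable_pi_apply i).comp hc
  have hscore : ∀ i, Measurable fun z =>
      score C m n (nested ρ m n t₀ (h (D z) (c z i).1)) (c z i).2 := fun i =>
    measurable_score (fun j => (H.measurable_hist j).comp (hD.prodMk (hci i).fst)) C ρ m n t₀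
      (hci i).snd
  refine measurable_nested (π := fun z => h (D z) (x z))
    (fun j => (H.measurable_hist j).comp (hD.prodMk hx)) ρ m n t₀ ?_
  exact (measurable_kthSmallest n _).comp (measurable_pi_lambda _ hscore)

theorem isTight_predict (D c : Fin n → 𝒳 × ℝ) (x : 𝒳) :
    IsTight m (h D x) (K * η) (level n (calIndex C α ρ m n t₀ (h D) c))
      (predict C α ρ m n t₀ (h D) c x) :=
  H.isTight D x (calIndex_le C α ρ m n t₀ (h D) c)

theorem trueMass_predict_mem_Icc (D c : Fin n → 𝒳 × ℝ) (x : 𝒳) :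
    trueMass (f x) C m (predict C α ρ m n t₀ (h D) c x) ∈ Set.Icc (0 : ℝ) 1 :=
  H.trueMass_mem_Icc D x (calIndex_le C α ρ m n t₀ (h D) c)

variable [IsProbabilityMeasure ν]

theorem measurable_measure_hitSet (t : ℕ) :
    Measurable fun D : Fin n → 𝒳 × ℝ => ν.real (hitSet C ρ m n t₀ (h D) t) :=
  (measurable_measure_prodMk_left (H.measurableSet_hitSet_prod t)).ennreal_toReal

theorem measurableSet_count_high (t : ℕ) (a : ℝ) : MeasurableSet
    {z : (Fin n → 𝒳 × ℝ) × (Fin n → 𝒳 × ℝ) | n * (ν.real (hitSet C ρ m n t₀ (h z.1) t) + a) ≤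
      count (hitSet C ρ m n t₀ (h z.1) t) z.2} :=
  measurableSet_le ((((H.measurable_measure_hitSet t).comp measurable_fst).add_const a).const_mul _)
    (H.measurable_count t)

theorem measurableSet_count_low (t : ℕ) (a : ℝ) : MeasurableSet
    {z : (Fin n → 𝒳 × ℝ) × (Fin n → 𝒳 × ℝ) | (count (hitSet C ρ m n t₀ (h z.1) t) z.2 : ℝ) ≤
      n * (ν.real (hitSet C ρ m n t₀ (h z.1) t) - a)} :=
  measurableSet_le (H.measurable_count t)
    ((((H.measurable_measure_hitSet t).comp measurable_fst).sub_const a).const_mul _)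

theorem measurableSet_good {Bad : Set ((Fin n → 𝒳 × ℝ) × (Fin n → 𝒳 × ℝ))}
    (hBad : MeasurableSet Bad) :
    MeasurableSet {w : (Fin n → 𝒳 × ℝ) × (Fin n → 𝒳 × ℝ) × 𝒳 |
      w.1 ∈ goodTrain ν f C η m h ∧ (w.1, w.2.1) ∉ Bad ∧
        sqErr C m (h w.1 w.2.2) (f w.2.2) < s ^ 2} := by
  have hw₂ : Measurable fun w : (Fin n → 𝒳 × ℝ) × (Fin n → 𝒳 × ℝ) × 𝒳 => (w.1, w.2.1) := by
    fun_prop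
  have hw₃ : Measurable fun w : (Fin n → 𝒳 × ℝ) × (Fin n → 𝒳 × ℝ) × 𝒳 => (w.1, w.2.2) := by
    fun_prop
  exact (measurable_fst H.measurableSet_goodTrain).inter ((hw₂ hBad).compl.inter
    (measurableSet_lt (H.measurable_sqErr.comp hw₃) measurable_const))

/-- The training sample and the new feature vector are good, and the calibration sample is not in
an exceptional set of small conditional probability, with high probability. -/
theorem le_measure_good {Bad : Set ((Fin n → 𝒳 × ℝ) × (Fin n → 𝒳 × ℝ))} (hBad : MeasurableSet Bad)
    {b : ℝ} (hb : 0 ≤ b)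
    (hsec : ∀ D, (Measure.pi fun _ : Fin n => ν).real {c | (D, c) ∈ Bad} ≤ b) :
    1 - (η + s + b) ≤ ((Measure.pi fun _ : Fin n => ν).prod
      ((Measure.pi fun _ : Fin n => ν).prod ν.fst)).real
      {w | w.1 ∈ goodTrain ν f C η m h ∧ (w.1, w.2.1) ∉ Bad ∧
        sqErr C m (h w.1 w.2.2) (f w.2.2) < s ^ 2} := by
  refine measureReal_good_le H.measurableSet_goodTrain H.measure_goodTrain_compl_le hBad hb hsec
    (measurableSet_le measurable_const H.measurable_sqErr) H.s_pos.le
    (fun D hD => H.measure_sq_le_sqErr_le hD) |>.trans (measureReal_mono ?_ (measure_ne_top _ _))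
  exact fun w hw => ⟨hw.1, hw.2.1, not_le.1 hw.2.2⟩

/-! ### Length and conditional coverage of the prediction interval -/

omit [IsProbabilityMeasure ν] in
theorem sqErr_bound_le {r : ℝ} (hr : r ≤ s ^ 2) : s + r / (2 * s) ≤ 3 / 2 * s := by
  have hs := H.s_pos
  have h1 : r / (2 * s) ≤ s ^ 2 / (2 * s) := by gcongr
  have h2 : s ^ 2 / (2 * s) = s / 2 := by field_simp
  linarith

theorem len_predict_le {D c : Fin n → 𝒳 × ℝ} {x : 𝒳} {a : ℝ} (ha : 0 ≤ a)
    (hD : D ∈ goodTrain ν f C η m h)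
    (hc : n * (ν.real (hitSet C ρ m n t₀ (h D) ⌈n * (1 - α + 3 / 2 * s + a) + 1⌉₊) - a) <
      (count (hitSet C ρ m n t₀ (h D) ⌈n * (1 - α + 3 / 2 * s + a) + 1⌉₊) c : ℝ))
    (hx : sqErr C m (h D x) (f x) < s ^ 2) {I : ℝ × ℝ}
    (hI : IsOracleInterval (f x) (1 - α) I) :
    len C m (predict C α ρ m n t₀ (h D) c x) ≤
      (I.2 - I.1) + 4 * C / m + K * (6 * s + a + 4 / n + K * η) := by
  have hlevel := H.level_calIndex_le hD rfl hc ha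
  have hs := H.s_pos
  have hlen := (H.isDensityOn x).len_nested_le H.C_pos H.K_pos H.rule_mem H.one_le_m
    (H.isHistogram D x) (mul_pos H.K_pos H.η_pos).le (H.hist_le D x) H.one_le_n H.start_le
    (calIndex_le C α ρ m n t₀ (h D) c) H.start_level (show 0 < 3 / 2 * s by positivity)
    (fun J h1 h2 h3 => ((H.isDensityOn x).abs_mass_sub_trueMass_le hs h1 h2 h3).trans
      (H.sqErr_bound_le hx.le))
    (show 0 ≤ 3 / 2 * s + a + 2 / n by positivity) (by linarith) hI
  refine hlen.trans_eq ?_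
  ring

theorem le_trueMass_predict {D c : Fin n → 𝒳 × ℝ} (x : 𝒳) {a θ : ℝ} (ha : 0 ≤ a)
    (hθ : θ = 1 - α - 3 / 2 * s - K * η - a)
    (hD : D ∈ goodTrain ν f C η m h)
    (hc : (count (hitSet C ρ m n t₀ (h D) (⌈n * θ⌉₊ - 1)) c : ℝ) <
      n * (ν.real (hitSet C ρ m n t₀ (h D) (⌈n * θ⌉₊ - 1)) + a)) :
    θ - (s + sqErr C m (h D x) (f x) / (2 * s)) ≤
      trueMass (f x) C m (predict C α ρ m n t₀ (h D) c x) := by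
  have h1 := H.le_level_calIndex hD hθ hc ha
  have h2 := (H.isTight_predict D c x).le_mass
  have h3 := abs_le.1 (H.abs_mass_sub_le D x (calIndex_le C α ρ m n t₀ (h D) c))
  have h4 : predict C α ρ m n t₀ (h D) c x =
    nested ρ m n t₀ (h D x) (calIndex C α ρ m n t₀ (h D) c) := rfl
  rw [h4] at h2 ⊢
  linarith

theorem integrable_trueMass_predict (x : 𝒳) : Integrable
    (fun z : (Fin n → 𝒳 × ℝ) × (Fin n → 𝒳 × ℝ) =>
      trueMass (f x) C m (predict C α ρ m n t₀ (h z.1) z.2 x))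
    ((Measure.pi fun _ : Fin n => ν).prod (Measure.pi fun _ : Fin n => ν)) := by
  have hJ : Measurable fun z : (Fin n → 𝒳 × ℝ) × (Fin n → 𝒳 × ℝ) =>
      predict C α ρ m n t₀ (h z.1) z.2 x :=
    H.measurable_predict measurable_fst measurable_snd measurable_const
  exact Integrable.of_mem_Icc 0 1
    (measurable_trueMass H.measurable_density measurable_const hJ).aemeasurable
    (ae_of_all _ fun z => H.trueMass_predict_mem_Icc z.1 z.2 x)

/-- For most feature vectors the error of the estimated distribution function, averaged over the
good training samples, is small. -/
theorem measure_sq_le_integral_indicator_le :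
    ν.fst.real {x | s ^ 2 ≤ ∫ D, (goodTrain ν f C η m h).indicator
      (fun D => sqErr C m (h D x) (f x)) D ∂(Measure.pi fun _ : Fin n => ν)} ≤ s := by
  set P := Measure.pi fun _ : Fin n => ν with hP
  set G := goodTrain ν f C η m h with hG
  have hGm : MeasurableSet G := H.measurableSet_goodTrain
  set F : 𝒳 × (Fin n → 𝒳 × ℝ) → ℝ :=
    fun q => G.indicator (fun D => sqErr C m (h D q.1) (f q.1)) q.2 with hF
  have hFm : Measurable F := by
    have : F = {q | q.2 ∈ G}.indicator fun q => sqErr C m (h q.2 q.1) (f q.1) := rfl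
    rw [this]
    exact (H.measurable_sqErr.comp measurable_swap).indicator (measurable_snd hGm)
  have hF01 : ∀ q, F q ∈ Set.Icc (0 : ℝ) m := by
    intro q
    by_cases hq : q.2 ∈ G
    · simpa [hF, hq] using H.sqErr_mem_Icc q.2 q.1
    · simp [hF, hq]
  have hFint : Integrable F (ν.fst.prod P) :=
    Integrable.of_mem_Icc 0 m hFm.aemeasurable (ae_of_all _ hF01)
  have h1 := mul_meas_ge_le_integral_of_nonneg
    (ae_of_all ν.fst fun x => integral_nonneg (μ := P) fun D => (hF01 (x, D)).1)
    hFint.integral_prod_left (s ^ 2)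
  have h2 : ∫ x, ∫ D, F (x, D) ∂P ∂ν.fst ≤ s ^ 3 := by
    rw [integral_integral_swap (f := fun x D => F (x, D)) hFint]
    have hs : 0 ≤ s ^ 3 := pow_nonneg H.s_pos.le 3
    calc ∫ D, ∫ x, F (x, D) ∂ν.fst ∂P ≤ ∫ _, s ^ 3 ∂P := by
          refine integral_mono hFint.swap.integral_prod_left (integrable_const _) fun D => ?_
          by_cases hD : D ∈ G
          · simpa [hF, hD] using H.integral_sqErr_le hD
          · simpa [hF, hD] using hs
      _ = s ^ 3 := by simp
  have hs : 0 < s ^ 2 := pow_pos H.s_pos 2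
  refine le_of_mul_le_mul_left ((h1.trans h2).trans_eq ?_) hs
  ring

/-- Coverage given the feature vector alone: the bound is integrated over the training and
calibration samples, and the exceptional samples cost at most their probability. -/
theorem le_integral_trueMass_predict {x : 𝒳} {a θ b : ℝ} (ha : 0 ≤ a)
    (hθ : θ = 1 - α - 3 / 2 * s - K * η - a) (hb : 0 ≤ b)
    (hsec : ∀ D, (Measure.pi fun _ : Fin n => ν).real
      {c | n * (ν.real (hitSet C ρ m n t₀ (h D) (⌈n * θ⌉₊ - 1)) + a) ≤
        (count (hitSet C ρ m n t₀ (h D) (⌈n * θ⌉₊ - 1)) c : ℝ)} ≤ b)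
    (hx : ∫ D, (goodTrain ν f C η m h).indicator
      (fun D => sqErr C m (h D x) (f x)) D ∂(Measure.pi fun _ : Fin n => ν) < s ^ 2) :
    θ - (η + b + 3 / 2 * s) ≤ ∫ z : (Fin n → 𝒳 × ℝ) × (Fin n → 𝒳 × ℝ),
      trueMass (f x) C m (predict C α ρ m n t₀ (h z.1) z.2 x)
        ∂((Measure.pi fun _ : Fin n => ν).prod (Measure.pi fun _ : Fin n => ν)) := by
  set P := Measure.pi fun _ : Fin n => ν with hP
  set G := goodTrain ν f C η m h with hG
  have hGm : MeasurableSet G := H.measurableSet_goodTrain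
  set Bad := {z : (Fin n → 𝒳 × ℝ) × (Fin n → 𝒳 × ℝ) |
    n * (ν.real (hitSet C ρ m n t₀ (h z.1) (⌈n * θ⌉₊ - 1)) + a) ≤
      (count (hitSet C ρ m n t₀ (h z.1) (⌈n * θ⌉₊ - 1)) z.2 : ℝ)} with hBad
  have hBadm : MeasurableSet Bad := H.measurableSet_count_high _ _
  have hθ1 : θ ≤ 1 := by
    have := mul_pos H.K_pos H.η_pos
    linarith [H.α_pos, H.s_pos]
  have hs := H.s_pos
  set R : (Fin n → 𝒳 × ℝ) → ℝ := G.indicator fun D => sqErr C m (h D x) (f x) with hR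
  have hR0 : ∀ D, R D ∈ Set.Icc (0 : ℝ) m := by
    intro D
    by_cases hD : D ∈ G
    · simpa [hR, hD] using H.sqErr_mem_Icc D x
    · simp [hR, hD]
  have hRint : Integrable R P := Integrable.of_mem_Icc 0 m
    ((H.measurable_sqErr.comp measurable_prodMk_right).indicator hGm).aemeasurable
    (ae_of_all _ hR0)
  have hi1 : Integrable (fun z : (Fin n → 𝒳 × ℝ) × (Fin n → 𝒳 × ℝ) =>
      Gᶜ.indicator (fun _ => (1 : ℝ)) z.1) (P.prod P) :=
    (Integrable.indicator (integrable_const (1 : ℝ)) hGm.compl).comp_fst P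
  have hi2 : Integrable (Bad.indicator fun _ => (1 : ℝ)) (P.prod P) :=
    (integrable_const (1 : ℝ)).indicator hBadm
  have hi3 : Integrable (fun z : (Fin n → 𝒳 × ℝ) × (Fin n → 𝒳 × ℝ) => R z.1 / (2 * s))
      (P.prod P) := (hRint.comp_fst P).div_const _
  have hi12 : Integrable (fun z : (Fin n → 𝒳 × ℝ) × (Fin n → 𝒳 × ℝ) =>
      Gᶜ.indicator (fun _ => (1 : ℝ)) z.1 + Bad.indicator (fun _ => (1 : ℝ)) z) (P.prod P) :=
    hi1.add hi2
  have hi123 : Integrable (fun z : (Fin n → 𝒳 × ℝ) × (Fin n → 𝒳 × ℝ) =>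
      Gᶜ.indicator (fun _ => (1 : ℝ)) z.1 + Bad.indicator (fun _ => (1 : ℝ)) z +
        R z.1 / (2 * s)) (P.prod P) := hi12.add hi3
  -- On the exceptional samples the left-hand side is at most `θ - 1 ≤ 0`.
  have hpoint : ∀ z : (Fin n → 𝒳 × ℝ) × (Fin n → 𝒳 × ℝ),
      (θ - s) - (Gᶜ.indicator (fun _ => (1 : ℝ)) z.1 + Bad.indicator (fun _ => (1 : ℝ)) z +
        R z.1 / (2 * s)) ≤ trueMass (f x) C m (predict C α ρ m n t₀ (h z.1) z.2 x) := by
    intro z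
    have h0 := (H.trueMass_predict_mem_Icc z.1 z.2 x (α := α)).1
    have hRz : 0 ≤ R z.1 / (2 * s) := div_nonneg (hR0 _).1 (by positivity)
    by_cases h1 : z.1 ∈ G
    · by_cases h2 : z ∈ Bad
      · simp only [Set.indicator_of_notMem (show z.1 ∉ Gᶜ from fun h => h h1),
          Set.indicator_of_mem h2]
        linarith
      · have hmain := H.le_trueMass_predict x ha hθ h1 (not_le.1 h2)
        simp only [Set.indicator_of_notMem (show z.1 ∉ Gᶜ from fun h => h h1),
          Set.indicator_of_notMem h2, hR, Set.indicator_of_mem h1]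
        linarith
    · have h3 : 0 ≤ Bad.indicator (fun _ => (1 : ℝ)) z :=
        Set.indicator_nonneg (fun _ _ => zero_le_one) z
      simp only [Set.indicator_of_mem (show z.1 ∈ Gᶜ from h1)]
      linarith
  have hPG : ∫ z : (Fin n → 𝒳 × ℝ) × (Fin n → 𝒳 × ℝ),
      Gᶜ.indicator (fun _ => (1 : ℝ)) z.1 ∂(P.prod P) ≤ η := by
    rw [integral_fun_fst (μ := P) (ν := P) (Gᶜ.indicator fun _ => (1 : ℝ)),
      integral_indicator_const _ hGm.compl]
    simpa using H.measure_goodTrain_compl_le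
  have hPB : ∫ z, Bad.indicator (fun _ => (1 : ℝ)) z ∂(P.prod P) ≤ b := by
    rw [integral_indicator_const _ hBadm, smul_eq_mul, mul_one]
    exact measureReal_prod_le hBadm hb hsec
  have hPR : ∫ z : (Fin n → 𝒳 × ℝ) × (Fin n → 𝒳 × ℝ), R z.1 / (2 * s) ∂(P.prod P) ≤ s / 2 := by
    rw [integral_div, integral_fun_fst (μ := P) (ν := P) R]
    simp only [probReal_univ, one_smul]
    have h1 : (∫ D, R D ∂P) / (2 * s) ≤ s ^ 2 / (2 * s) := by gcongr
    exact h1.trans_eq (by field_simp)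
  calc θ - (η + b + 3 / 2 * s) ≤ ∫ z : (Fin n → 𝒳 × ℝ) × (Fin n → 𝒳 × ℝ), ((θ - s) -
        (Gᶜ.indicator (fun _ => (1 : ℝ)) z.1 + Bad.indicator (fun _ => (1 : ℝ)) z +
          R z.1 / (2 * s))) ∂(P.prod P) := by
        rw [integral_sub (integrable_const _) hi123, integral_add hi12 hi3, integral_add hi1 hi2]
        simp only [integral_const, probReal_univ, one_smul]
        linarith
    _ ≤ _ := integral_mono ((integrable_const _).sub hi123)
        (H.integrable_trueMass_predict x) hpoint

end Setting

end Fixed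

/-! ### Limits of the rate sequences -/

theorem tendsto_rpow_third {η : ℕ → ℝ} (hη0 : Tendsto η atTop (𝓝 0)) :
    Tendsto (fun n => η n ^ (1 / 3 : ℝ)) atTop (𝓝 0) := by
  simpa using hη0.rpow_const (p := 1 / 3) (Or.inr (by norm_num))

theorem tendsto_sqrt_log_div : Tendsto (fun n : ℕ => √(Real.log n / n)) atTop (𝓝 0) := by
  have h : Tendsto (fun x : ℝ => Real.log x / x) atTop (𝓝 0) := by
    simpa using Real.tendsto_pow_log_div_mul_add_atTop 1 0 1 one_ne_zero
  simpa using (h.comp tendsto_natCast_atTop_atTop).sqrt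

theorem tendsto_epsSeq (K : ℝ) {η : ℕ → ℝ} (hη0 : Tendsto η atTop (𝓝 0)) :
    Tendsto (epsSeq K η) atTop (𝓝 0) := by
  unfold epsSeq
  simpa using (((tendsto_const_div_atTop_nhds_zero_nat 2).add
    ((tendsto_rpow_third hη0).const_mul 5)).add (hη0.const_mul (1 + 2 * K))).add
      (tendsto_sqrt_log_div.const_mul 2)

theorem tendsto_gammaSeq (C K : ℝ) {η : ℕ → ℝ} (hη0 : Tendsto η atTop (𝓝 0)) :
    Tendsto (gammaSeq C K η) atTop (𝓝 0) := by
  unfold gammaSeq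
  simpa using (hη0.const_mul (4 * C)).add
    (((tendsto_epsSeq K hη0).add ((tendsto_rpow_third hη0).const_mul 2)).const_mul K)

theorem tendsto_xiSeq {η : ℕ → ℝ} (hη0 : Tendsto η atTop (𝓝 0)) :
    Tendsto (xiSeq η) atTop (𝓝 0) := by
  unfold xiSeq
  have h : Tendsto (fun n : ℕ => 2 / (n : ℝ) ^ 2) atTop (𝓝 0) :=
    Tendsto.div_atTop tendsto_const_nhds
      ((tendsto_pow_atTop two_ne_zero).comp tendsto_natCast_atTop_atTop)
  simpa using ((tendsto_rpow_third hη0).add hη0).add h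

/-! ### The prediction interval on the probability space -/

section Sample

variable {Ω 𝒳 : Type*} [MeasurableSpace Ω] [MeasurableSpace 𝒳] {μ : Measure Ω}
  [IsProbabilityMeasure μ] {X : ℕ → Ω → 𝒳} {Y : ℕ → Ω → ℝ}
  (hX : ∀ i, Measurable (X i)) (hY : ∀ i, Measurable (Y i))
  (hindep : iIndepFun (fun i ω => (X i ω, Y i ω)) μ)
  (hident : ∀ i, IdentDistrib (fun ω => (X i ω, Y i ω)) (fun ω => (X 0 ω, Y 0 ω)) μ μ)

include hX hY

theorem measurable_train (n : ℕ) : Measurable (train X Y n) :=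
  measurable_pi_lambda _ fun i => (hX i).prodMk (hY i)

theorem measurable_calib (n : ℕ) : Measurable (calib X Y n) :=
  measurable_pi_lambda _ fun i => (hX (n + i)).prodMk (hY (n + i))

theorem measurable_data (n : ℕ) :
    Measurable fun ω => (train X Y n ω, calib X Y n ω, X (2 * n) ω) :=
  (measurable_train hX hY n).prodMk ((measurable_calib hX hY n).prodMk (hX _))

include hindep hident

theorem map_train (n : ℕ) : μ.map (train X Y n) =
    Measure.pi fun _ : Fin n => μ.map fun ω => (X 0 ω, Y 0 ω) := by
  have h := map_block_eq_pi (fun i => (hX i).prodMk (hY i)) hindep hident n 0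
  simp only [Nat.zero_add] at h
  exact h

theorem map_data (n : ℕ) :
    μ.map (fun ω => (train X Y n ω, calib X Y n ω, X (2 * n) ω)) =
      (Measure.pi fun _ : Fin n => μ.map fun ω => (X 0 ω, Y 0 ω)).prod
        ((Measure.pi fun _ : Fin n => μ.map fun ω => (X 0 ω, Y 0 ω)).prod
          (μ.map fun ω => (X 0 ω, Y 0 ω)).fst) := by
  have hZ0 : IsProbabilityMeasure (μ.map fun ω => (X 0 ω, Y 0 ω)) :=
    Measure.isProbabilityMeasure_map ((hX 0).prodMk (hY 0)).aemeasurable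
  have h := map_samples_eq_prod (fun i => (hX i).prodMk (hY i)) hindep hident n
  have hφ : Measurable fun z : (Fin n → 𝒳 × ℝ) × (Fin n → 𝒳 × ℝ) × (𝒳 × ℝ) =>
      (z.1, z.2.1, z.2.2.1) := by fun_prop
  have hW : Measurable fun ω => (train X Y n ω, calib X Y n ω, (X (2 * n) ω, Y (2 * n) ω)) :=
    (measurable_train hX hY n).prodMk ((measurable_calib hX hY n).prodMk ((hX _).prodMk (hY _)))
  have h' : μ.map (fun ω => (train X Y n ω, calib X Y n ω, X (2 * n) ω)) =
      (μ.map fun ω => (train X Y n ω, calib X Y n ω, (X (2 * n) ω, Y (2 * n) ω))).map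
        fun z => (z.1, z.2.1, z.2.2.1) := (Measure.map_map hφ hW).symm
  rw [h']
  unfold train calib
  rw [h]
  have e1 := Measure.map_prod_map (Measure.pi fun _ : Fin n => μ.map fun ω => (X 0 ω, Y 0 ω))
    (μ.map fun ω => (X 0 ω, Y 0 ω)) measurable_id measurable_fst
  have e2 := Measure.map_prod_map (Measure.pi fun _ : Fin n => μ.map fun ω => (X 0 ω, Y 0 ω))
    ((Measure.pi fun _ : Fin n => μ.map fun ω => (X 0 ω, Y 0 ω)).prod
      (μ.map fun ω => (X 0 ω, Y 0 ω))) measurable_id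
    (measurable_id.prodMap measurable_fst)
  rw [← e1, Measure.map_id] at e2
  exact e2.symm

namespace Setting

variable {f : 𝒳 → ℝ → ℝ} {C K α η s : ℝ} {n m t₀ : ℕ}
  {h : (Fin n → 𝒳 × ℝ) → 𝒳 → ℕ → ℝ} {ρ : Finset (ℕ × ℕ) → ℕ × ℕ}
  (H : Setting (μ.map fun ω => (X 0 ω, Y 0 ω)) f C K α η s n m t₀ h ρ)
include H

/-- A property of the data that holds for good training samples and feature vectors, outside of a
set of calibration samples of small conditional probability, holds with high probability. -/
theorem le_measure_of_good {Bad : Set ((Fin n → 𝒳 × ℝ) × (Fin n → 𝒳 × ℝ))}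
    (hBad : MeasurableSet Bad) {b : ℝ} (hb : 0 ≤ b)
    (hsec : ∀ D, (Measure.pi fun _ : Fin n => μ.map fun ω => (X 0 ω, Y 0 ω)).real
      {c | (D, c) ∈ Bad} ≤ b)
    {p : Ω → Prop}
    (hp : ∀ᵐ ω ∂μ, train X Y n ω ∈ goodTrain (μ.map fun ω => (X 0 ω, Y 0 ω)) f C η m h →
      (train X Y n ω, calib X Y n ω) ∉ Bad →
      sqErr C m (h (train X Y n ω) (X (2 * n) ω)) (f (X (2 * n) ω)) < s ^ 2 → p ω) :
    1 - (η + s + b) ≤ μ.real {ω | p ω} := by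
  have hZ0 : IsProbabilityMeasure (μ.map fun ω => (X 0 ω, Y 0 ω)) :=
    Measure.isProbabilityMeasure_map ((hX 0).prodMk (hY 0)).aemeasurable
  have hW := measurable_data hX hY n
  refine (H.le_measure_good hBad hb hsec).trans ?_
  rw [← map_data hX hY hindep hident n, map_measureReal_apply hW (H.measurableSet_good hBad)]
  refine ENNReal.toReal_mono (measure_ne_top _ _) (measure_mono_ae ?_)
  filter_upwards [hp] with ω hω hgood
  exact hω hgood.1 hgood.2.1 hgood.2.2

theorem measure_preimage_inter_covered
    {B : Set ((Fin n → 𝒳 × ℝ) × (Fin n → 𝒳 × ℝ) × 𝒳)} (hB : MeasurableSet B) :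
    μ ((fun ω => (train X Y n ω, calib X Y n ω, X (2 * n) ω)) ⁻¹' B ∩
      {ω | Y (2 * n) ω ∈ toSet C m (predict C α ρ m n t₀ (h (train X Y n ω)) (calib X Y n ω)
        (X (2 * n) ω))}) =
    ∫⁻ w in B, ENNReal.ofReal (trueMass (f w.2.2) C m (predict C α ρ m n t₀ (h w.1) w.2.1 w.2.2))
      ∂((Measure.pi fun _ : Fin n => μ.map fun ω => (X 0 ω, Y 0 ω)).prod
        ((Measure.pi fun _ : Fin n => μ.map fun ω => (X 0 ω, Y 0 ω)).prod
          (μ.map fun ω => (X 0 ω, Y 0 ω)).fst)) := by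
  have hZ0 : IsProbabilityMeasure (μ.map fun ω => (X 0 ω, Y 0 ω)) :=
    Measure.isProbabilityMeasure_map ((hX 0).prodMk (hY 0)).aemeasurable
  have hJ : Measurable fun w : (Fin n → 𝒳 × ℝ) × (Fin n → 𝒳 × ℝ) × 𝒳 =>
      predict C α ρ m n t₀ (h w.1) w.2.1 w.2.2 :=
    H.measurable_predict measurable_fst measurable_snd.fst measurable_snd.snd
  rw [← measure_prod_mem_toSet H.C_pos.le H.measurable_density H.isDensityOn H.law _ _ hJ
    (fun w => (H.isTight_predict w.1 w.2.1 w.2.2).le) hB,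
    ← map_samples_eq_prod (fun i => (hX i).prodMk (hY i)) hindep hident n]
  have hφ : Measurable fun z : (Fin n → 𝒳 × ℝ) × (Fin n → 𝒳 × ℝ) × (𝒳 × ℝ) =>
      (z.1, z.2.1, z.2.2.1) := by fun_prop
  have hW : Measurable fun ω => (train X Y n ω, calib X Y n ω, (X (2 * n) ω, Y (2 * n) ω)) :=
    (measurable_train hX hY n).prodMk ((measurable_calib hX hY n).prodMk ((hX _).prodMk (hY _)))
  have hS := (hφ hB).inter (measurableSet_mem_toSet C m
    (H.measurable_predict (α := α) (D := fun z : (Fin n → 𝒳 × ℝ) × (Fin n → 𝒳 × ℝ) × (𝒳 × ℝ) => z.1)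
      (c := fun z => z.2.1) (x := fun z => z.2.2.1) (by fun_prop) (by fun_prop) (by fun_prop))
    (show Measurable fun z : (Fin n → 𝒳 × ℝ) × (Fin n → 𝒳 × ℝ) × (𝒳 × ℝ) => z.2.2.2 by fun_prop))
  exact (Measure.map_apply hW hS).symm

/-- The conditional coverage given all the data is the mass that the conditional density gives to
the prediction interval. -/
theorem condExp_sigmaData :
    μ⟦{ω | Y (2 * n) ω ∈ toSet C m (predict C α ρ m n t₀ (h (train X Y n ω)) (calib X Y n ω)
        (X (2 * n) ω))} | sigmaData X Y n⟧ =ᵐ[μ]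
      fun ω => trueMass (f (X (2 * n) ω)) C m
        (predict C α ρ m n t₀ (h (train X Y n ω)) (calib X Y n ω) (X (2 * n) ω)) := by
  have hJ : Measurable fun w : (Fin n → 𝒳 × ℝ) × (Fin n → 𝒳 × ℝ) × 𝒳 =>
      predict C α ρ m n t₀ (h w.1) w.2.1 w.2.2 :=
    H.measurable_predict measurable_fst measurable_snd.fst measurable_snd.snd
  have hA := measurableSet_mem_toSet C m (H.measurable_predict (measurable_train hX hY n)
    (measurable_calib hX hY n) (hX (2 * n))) (hY (2 * n))
  refine condExp_indicator_ae_eq (measurable_data hX hY n) hA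
    (g := fun w => trueMass (f w.2.2) C m (predict C α ρ m n t₀ (h w.1) w.2.1 w.2.2))
    (measurable_trueMass H.measurable_density measurable_snd.snd hJ)
    (fun w => H.trueMass_predict_mem_Icc w.1 w.2.1 w.2.2) fun B hB => ?_
  rw [map_data hX hY hindep hident n]
  exact H.measure_preimage_inter_covered hX hY hindep hident hB

/-- The conditional coverage given the features is the mass of the prediction interval, averaged
over the training and calibration samples. -/
theorem condExp_sigmaTest :
    μ⟦{ω | Y (2 * n) ω ∈ toSet C m (predict C α ρ m n t₀ (h (train X Y n ω)) (calib X Y n ω)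
        (X (2 * n) ω))} | sigmaTest X n⟧ =ᵐ[μ]
      fun ω => ∫ z : (Fin n → 𝒳 × ℝ) × (Fin n → 𝒳 × ℝ), trueMass (f (X (2 * n) ω)) C m
        (predict C α ρ m n t₀ (h z.1) z.2 (X (2 * n) ω))
          ∂((Measure.pi fun _ : Fin n => μ.map fun ω => (X 0 ω, Y 0 ω)).prod
            (Measure.pi fun _ : Fin n => μ.map fun ω => (X 0 ω, Y 0 ω))) := by
  have hZ0 : IsProbabilityMeasure (μ.map fun ω => (X 0 ω, Y 0 ω)) :=
    Measure.isProbabilityMeasure_map ((hX 0).prodMk (hY 0)).aemeasurable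
  have hA := measurableSet_mem_toSet C m (H.measurable_predict (measurable_train hX hY n)
    (measurable_calib hX hY n) (hX (2 * n))) (hY (2 * n))
  have hlaw : μ.map (X (2 * n)) = (μ.map fun ω => (X 0 ω, Y 0 ω)).fst := by
    rw [← (hident (2 * n)).map_eq, Measure.fst_map_prodMk (hY _)]
  set P := Measure.pi fun _ : Fin n => μ.map fun ω => (X 0 ω, Y 0 ω)
  set V := (μ.map fun ω => (X 0 ω, Y 0 ω)).fst
  have hJ : Measurable fun q : ((Fin n → 𝒳 × ℝ) × (Fin n → 𝒳 × ℝ)) × 𝒳 =>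
      predict C α ρ m n t₀ (h q.1.1) q.1.2 q.2 :=
    H.measurable_predict measurable_fst.fst measurable_fst.snd measurable_snd
  have hg : Measurable fun q : ((Fin n → 𝒳 × ℝ) × (Fin n → 𝒳 × ℝ)) × 𝒳 =>
      trueMass (f q.2) C m (predict C α ρ m n t₀ (h q.1.1) q.1.2 q.2) :=
    measurable_trueMass H.measurable_density measurable_snd hJ
  have hg₂ : Measurable fun x => ∫ z : (Fin n → 𝒳 × ℝ) × (Fin n → 𝒳 × ℝ),
      trueMass (f x) C m (predict C α ρ m n t₀ (h z.1) z.2 x) ∂(P.prod P) :=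
    (hg.stronglyMeasurable.integral_prod_left (μ := P.prod P)).measurable
  refine condExp_indicator_ae_eq (hX (2 * n)) hA hg₂ (fun x => ⟨?_, ?_⟩) fun B hB => ?_
  · exact integral_nonneg fun z => (H.trueMass_predict_mem_Icc z.1 z.2 x).1
  · refine (integral_mono (H.integrable_trueMass_predict x) (integrable_const 1)
      fun z => (H.trueMass_predict_mem_Icc z.1 z.2 x).2).trans_eq (by simp)
  have hB' : MeasurableSet {w : (Fin n → 𝒳 × ℝ) × (Fin n → 𝒳 × ℝ) × 𝒳 | w.2.2 ∈ B} :=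
    measurable_snd.snd hB
  have h1 := H.measure_preimage_inter_covered hX hY hindep hident hB'
  refine h1.trans ?_
  have hB'' : MeasurableSet {q : ((Fin n → 𝒳 × ℝ) × (Fin n → 𝒳 × ℝ)) × 𝒳 | q.2 ∈ B} :=
    measurable_snd hB
  rw [hlaw, ← lintegral_indicator hB', ← lintegral_indicator hB, ← Measure.prodAssoc_prod,
    lintegral_map_equiv]
  refine (lintegral_prod_symm _ (hg.ennreal_ofReal.indicator hB'').aemeasurable).trans
    (lintegral_congr fun x => ?_)
  by_cases hx : x ∈ B
  · rw [Set.indicator_of_mem hx, ofReal_integral_eq_lintegral_ofReal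
      (H.integrable_trueMass_predict x)
      (ae_of_all _ fun z => (H.trueMass_predict_mem_Icc z.1 z.2 x).1)]
    simp [Set.indicator, hx]
  · simp [Set.indicator, hx]

/-! ### The high probability bounds -/

omit hX hY hindep hident [IsProbabilityMeasure μ] in
theorem rate_bounds : 0 < K * η ∧ 0 ≤ √(Real.log n / n) ∧ 0 ≤ 1 / (n : ℝ) ^ 2 ∧
    1 / (n : ℝ) ^ 2 ≤ 1 / n := by
  have hn : (1 : ℝ) ≤ n := by exact_mod_cast H.one_le_n
  refine ⟨mul_pos H.K_pos H.η_pos, Real.sqrt_nonneg _, by positivity, ?_⟩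
  exact one_div_le_one_div_of_le (by linarith) (le_self_pow₀ hn two_ne_zero)

theorem le_measure_len {orc : 𝒳 → ℝ × ℝ} (horc : ∀ x, IsOracleInterval (f x) (1 - α) (orc x)) :
    1 - (η + s + 1 / (n : ℝ) ^ 2) ≤ μ.real {ω |
      len C m (predict C α ρ m n t₀ (h (train X Y n ω)) (calib X Y n ω) (X (2 * n) ω)) ≤
        ((orc (X (2 * n) ω)).2 - (orc (X (2 * n) ω)).1) + 4 * C / m +
          K * (6 * s + √(Real.log n / n) + 4 / n + K * η)} := by
  have hZ0 : IsProbabilityMeasure (μ.map fun ω => (X 0 ω, Y 0 ω)) :=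
    Measure.isProbabilityMeasure_map ((hX 0).prodMk (hY 0)).aemeasurable
  obtain ⟨-, ha, hb, -⟩ := H.rate_bounds
  refine H.le_measure_of_good hX hY hindep hident
    (H.measurableSet_count_low ⌈n * (1 - α + 3 / 2 * s + √(Real.log n / n)) + 1⌉₊
      √(Real.log n / n)) hb (fun D => ?_) (ae_of_all _ fun ω h1 h2 h3 => ?_)
  · exact (measure_count_le_le (H.measurableSet_hitSet D _) n ha).trans_eq H.exp_hoeffding
  · exact H.len_predict_le ha h1 (not_le.1 h2) h3 (horc _)

theorem le_measure_condExp_sigmaData :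
    1 - (η + s + 1 / (n : ℝ) ^ 2) ≤ μ.real {ω |
      1 - α - (3 * s + K * η + √(Real.log n / n)) ≤
        (μ⟦{ω | Y (2 * n) ω ∈ toSet C m (predict C α ρ m n t₀ (h (train X Y n ω)) (calib X Y n ω)
          (X (2 * n) ω))} | sigmaData X Y n⟧) ω} := by
  have hZ0 : IsProbabilityMeasure (μ.map fun ω => (X 0 ω, Y 0 ω)) :=
    Measure.isProbabilityMeasure_map ((hX 0).prodMk (hY 0)).aemeasurable
  obtain ⟨-, ha, hb, -⟩ := H.rate_bounds
  refine H.le_measure_of_good hX hY hindep hident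
    (H.measurableSet_count_high
      (⌈n * (1 - α - 3 / 2 * s - K * η - √(Real.log n / n))⌉₊ - 1) √(Real.log n / n)) hb
      (fun D => ?_) ?_
  · exact (measure_le_count_le (H.measurableSet_hitSet D _) n ha).trans_eq H.exp_hoeffding
  · filter_upwards [H.condExp_sigmaData hX hY hindep hident] with ω hω h1 h2 h3
    rw [hω]
    have h4 := H.le_trueMass_predict (X (2 * n) ω) ha rfl h1 (not_le.1 h2)
    have h5 := H.sqErr_bound_le h3.le
    linarith

theorem le_measure_condExp_sigmaTest :
    1 - s ≤ μ.real {ω |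
      1 - α - (3 * s + K * η + √(Real.log n / n) + η + 1 / (n : ℝ) ^ 2) ≤
        (μ⟦{ω | Y (2 * n) ω ∈ toSet C m (predict C α ρ m n t₀ (h (train X Y n ω)) (calib X Y n ω)
          (X (2 * n) ω))} | sigmaTest X n⟧) ω} := by
  have hZ0 : IsProbabilityMeasure (μ.map fun ω => (X 0 ω, Y 0 ω)) :=
    Measure.isProbabilityMeasure_map ((hX 0).prodMk (hY 0)).aemeasurable
  obtain ⟨-, ha, hb, -⟩ := H.rate_bounds
  have hlaw : μ.map (X (2 * n)) = (μ.map fun ω => (X 0 ω, Y 0 ω)).fst := by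
    rw [← (hident (2 * n)).map_eq, Measure.fst_map_prodMk (hY _)]
  set F : 𝒳 → ℝ := fun x => ∫ D, (goodTrain (μ.map fun ω => (X 0 ω, Y 0 ω)) f C η m h).indicator
    (fun D => sqErr C m (h D x) (f x)) D ∂(Measure.pi fun _ : Fin n => μ.map fun ω =>
      (X 0 ω, Y 0 ω)) with hF
  have hFm : Measurable F := by
    have h1 : Measurable fun q : 𝒳 × (Fin n → 𝒳 × ℝ) =>
        {q : 𝒳 × (Fin n → 𝒳 × ℝ) |
          q.2 ∈ goodTrain (μ.map fun ω => (X 0 ω, Y 0 ω)) f C η m h}.indicator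
            (fun q => sqErr C m (h q.2 q.1) (f q.1)) q :=
      (H.measurable_sqErr.comp measurable_swap).indicator
        (measurable_snd H.measurableSet_goodTrain)
    exact (h1.stronglyMeasurable.integral_prod_right (ν := Measure.pi fun _ : Fin n =>
      μ.map fun ω => (X 0 ω, Y 0 ω))).measurable
  have hset : MeasurableSet {x | s ^ 2 ≤ F x} := measurableSet_le measurable_const hFm
  have h1 : 1 - s ≤ μ.real (X (2 * n) ⁻¹' {x | s ^ 2 ≤ F x}ᶜ) := by
    rw [← map_measureReal_apply (hX _) hset.compl, hlaw, probReal_compl_eq_one_sub hset]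
    linarith [H.measure_sq_le_integral_indicator_le]
  refine h1.trans (ENNReal.toReal_mono (measure_ne_top _ _) (measure_mono_ae ?_))
  filter_upwards [H.condExp_sigmaTest hX hY hindep hident] with ω hω hx
  have h2 := H.le_integral_trueMass_predict ha rfl hb
    (fun D => (measure_le_count_le (H.measurableSet_hitSet D _) n ha).trans_eq H.exp_hoeffding)
    (not_le.1 hx)
  change _ ≤ _
  rw [hω]
  linarith

end Setting

end Sample

/-! ### Comparison with the rate sequences -/

theorem one_le_log {n : ℕ} (hn : 3 ≤ n) : 1 ≤ Real.log n := by
  rw [Real.le_log_iff_exp_le (by positivity)]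
  exact Real.exp_one_lt_three.le.trans (by exact_mod_cast hn)

theorem two_div_le_sqrt_log {n : ℕ} (hn : 4 ≤ n) : 2 / (n : ℝ) ≤ √(Real.log n / n) := by
  have hn' : (4 : ℝ) ≤ n := by exact_mod_cast hn
  have hlog := one_le_log (show 3 ≤ n by omega)
  refine Real.le_sqrt_of_sq_le ?_
  rw [div_pow, div_le_div_iff₀ (by positivity) (by positivity)]
  have : (n : ℝ) * 4 ≤ n * n := by gcongr
  have : (n : ℝ) ^ 2 * 1 ≤ n ^ 2 * Real.log n := by gcongr
  nlinarith

theorem one_le_two_div_add {n : ℕ} (hn : 1 ≤ n) (hn3 : n ≤ 3) :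
    1 ≤ 2 / (n : ℝ) + 2 * √(Real.log n / n) := by
  have h0 := Real.sqrt_nonneg (Real.log n / n)
  interval_cases n
  · norm_num at h0 ⊢
  · norm_num at h0 ⊢
    exact h0
  · have h1 : 1 / 2 ≤ √(Real.log (3 : ℕ) / (3 : ℕ)) := by
      refine Real.le_sqrt_of_sq_le ?_
      have := one_le_log (le_refl 3)
      rw [le_div_iff₀ (by norm_num)]
      norm_num at this ⊢
      linarith
    norm_num at h1 ⊢
    linarith

end CHR

end

theorem theorem2 {Ω : Type*} [MeasurableSpace Ω] (μ : Measure Ω) [IsProbabilityMeasure μ] (p : ℕ)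
    (X : ℕ → Ω → EuclideanSpace ℝ (Fin p)) (Y : ℕ → Ω → ℝ)
    (f : EuclideanSpace ℝ (Fin p) → ℝ → ℝ) (C K α : ℝ) (η : ℕ → ℝ)
    (pihat : (n : ℕ) → (Fin n → EuclideanSpace ℝ (Fin p) × ℝ) →
      EuclideanSpace ℝ (Fin p) → ℕ → ℝ)
    (ρ : ℕ → Finset (ℕ × ℕ) → ℕ × ℕ) (t₀ : ℕ → ℕ)
    (orc : EuclideanSpace ℝ (Fin p) → ℝ × ℝ)
    (hC : 0 < C) (hK : 0 < K) (hα0 : 0 < α) (hα1 : α ≤ 1)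
    -- the data are i.i.d.
    (hX : ∀ i, Measurable (X i)) (hY : ∀ i, Measurable (Y i))
    (hindep : iIndepFun (fun i ω => (X i ω, Y i ω)) μ)
    (hident : ∀ i, IdentDistrib (fun ω => (X i ω, Y i ω)) (fun ω => (X 0 ω, Y 0 ω)) μ μ)
    -- regularity and unimodality of the conditional densities
    (hf : CHR.IsCondDensity μ (X 0) (Y 0) f)
    (hf_supp : ∀ x, ∀ y ∉ Set.Icc (-C) C, f x y = 0)
    (hf_bdd : ∀ x, ∀ y ∈ Set.Icc (-C) C, 1 / K < f x y ∧ f x y < K / 2)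
    (hf_uni : ∀ x, CHR.IsUnimodal C (f x))
    -- the estimator: measurable, histogram-valued, unimodal and bounded
    (hη : ∀ n ≥ 1, 0 < η n ∧ η n ≤ 1) (hη0 : Tendsto η atTop (𝓝 0))
    (hpi_meas : ∀ n ≥ 1, ∀ j, Measurable
      fun q : (Fin n → EuclideanSpace ℝ (Fin p) × ℝ) × EuclideanSpace ℝ (Fin p) =>
        pihat n q.1 q.2 j)
    (hpi_hist : ∀ n ≥ 1, ∀ D x, CHR.IsHistogram (CHR.numBins η n) (pihat n D x))
    (hpi_uni : ∀ n ≥ 1, ∀ D x, CHR.IsUnimodalHistogram (CHR.numBins η n) (pihat n D x))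
    (hpi_bdd : ∀ n ≥ 1, ∀ D x, ∀ j ∈ Finset.Icc 1 (CHR.numBins η n), pihat n D x j ≤ K * η n)
    -- consistency: the mean squared error at a new feature vector, given the training sample
    (hcons : ∀ n ≥ 1, ∀ j ∈ Finset.Icc 1 (CHR.numBins η n),
      1 - η n ^ 2 ≤ μ.real {ω | ∫ x, (∑ i ∈ Finset.Icc 1 j, pihat n (CHR.train X Y n ω) x i
        - CHR.cdfOf (f x) (CHR.edge C (CHR.numBins η n) j)) ^ 2 ∂(μ.map (X 0)) ≤ η n ^ 2})
    -- the rule that resolves the remaining ties, and the starting index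
    (hρ : ∀ n, ∀ A : Finset (ℕ × ℕ), A.Nonempty → ρ n A ∈ A)
    (ht₀ : ∀ n ≥ 1, t₀ n ≤ n ∧ |CHR.level n (t₀ n) - (1 - α)| ≤ 1 / n)
    -- the oracle
    (horc : ∀ x, CHR.IsOracleInterval (f x) (1 - α) (orc x)) :
    (Tendsto (CHR.gammaSeq C K η) atTop (𝓝 0) ∧ Tendsto (CHR.xiSeq η) atTop (𝓝 0) ∧
      Tendsto (CHR.epsSeq K η) atTop (𝓝 0) ∧ Tendsto (CHR.zetaSeq η) atTop (𝓝 0)) ∧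
    ∀ n ≥ 1,
      -- (i) length
      (1 - CHR.xiSeq η n ≤ μ.real {ω |
        CHR.len C (CHR.numBins η n) (CHR.chat X Y C α η ρ t₀ pihat n ω) ≤
          ((orc (X (2 * n) ω)).2 - (orc (X (2 * n) ω)).1) + CHR.gammaSeq C K η n}) ∧
      -- (ii) coverage, conditionally on the test features
      (1 - CHR.zetaSeq η n ≤ μ.real {ω | 1 - α - CHR.epsSeq K η n ≤
        (μ⟦CHR.covered X Y C α η ρ t₀ pihat n | CHR.sigmaTest X n⟧) ω}) ∧
      -- (ii) coverage, conditionally on the two samples and the test features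
      (1 - CHR.zetaSeq η n ≤ μ.real {ω | 1 - α - CHR.epsSeq K η n ≤
        (μ⟦CHR.covered X Y C α η ρ t₀ pihat n | CHR.sigmaData X Y n⟧) ω}) := by
  have hS : ∀ n ≥ 1, CHR.Setting (μ.map fun ω => (X 0 ω, Y 0 ω)) f C K α (η n)
      (η n ^ (1 / 3 : ℝ)) n (CHR.numBins η n) (t₀ n) (pihat n) (ρ n) := by
    intro n hn
    have hfst : (μ.map fun ω => (X 0 ω, Y 0 ω)).fst = μ.map (X 0) :=
      Measure.fst_map_prodMk (hY 0)
    refine ⟨hC, hK, hα0, hα1, hn, (hη n hn).1, (hη n hn).2, Real.rpow_pos_of_pos (hη n hn).1 _,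
      ?_, rfl, hf.measurable, fun x => ⟨hf.measurable.of_uncurry_left, hf.nonneg x,
        hf.lintegral_eq_one x, hf_supp x, fun y hy => (hf_bdd x y hy).1.le⟩, ?_, hpi_meas n hn,
      hpi_hist n hn, hpi_bdd n hn, fun j hj => ?_, hρ n, (ht₀ n hn).1, (ht₀ n hn).2⟩
    · rw [← Real.rpow_natCast, ← Real.rpow_mul (hη n hn).1.le]
      norm_num
    · rw [hfst]
      exact hf.map_eq
    · rw [hfst, ← CHR.map_train hX hY hindep hident n]
      have hm : Measurable fun D : Fin n → EuclideanSpace ℝ (Fin p) × ℝ =>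
          ∫ x, (∑ i ∈ Finset.Icc 1 j, pihat n D x i
            - CHR.cdfOf (f x) (CHR.edge C (CHR.numBins η n) j)) ^ 2 ∂(μ.map (X 0)) := by
        have h1 : Measurable fun q : (Fin n → EuclideanSpace ℝ (Fin p) × ℝ) ×
            EuclideanSpace ℝ (Fin p) => (∑ i ∈ Finset.Icc 1 j, pihat n q.1 q.2 i
              - CHR.cdfOf (f q.2) (CHR.edge C (CHR.numBins η n) j)) ^ 2 :=
          ((Finset.measurable_fun_sum _ fun i _ => hpi_meas n hn i).sub
            ((CHR.measurable_cdfOf hf.measurable _).comp measurable_snd)).pow_const 2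
        exact (h1.stronglyMeasurable.integral_prod_right (ν := μ.map (X 0))).measurable
      rw [map_measureReal_apply (CHR.measurable_train hX hY n)
        (measurableSet_le hm measurable_const)]
      exact hcons n hn j hj
  refine ⟨⟨CHR.tendsto_gammaSeq C K hη0, CHR.tendsto_xiSeq hη0, CHR.tendsto_epsSeq K hη0,
    CHR.tendsto_xiSeq hη0⟩, fun n hn => ?_⟩
  have H := hS n hn
  obtain ⟨hKη, ha, hb, hbn⟩ := H.rate_bounds
  have hs := H.s_pos
  have hη' := H.η_pos
  have hn0 : (0 : ℝ) < 1 / n := by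
    have : (0 : ℝ) < n := by exact_mod_cast hn
    positivity
  have hb2 : 2 / (n : ℝ) ^ 2 = 1 / (n : ℝ) ^ 2 + 1 / (n : ℝ) ^ 2 := by ring
  have h2n : 2 / (n : ℝ) = 1 / n + 1 / n := by ring
  have heps : CHR.epsSeq K η n = 2 / n + 5 * η n ^ (1 / 3 : ℝ) + (η n + 2 * (K * η n)) +
      2 * √(Real.log n / n) := by
    unfold CHR.epsSeq; ring
  have hsub : ∀ {A B : Set Ω}, A ⊆ B → μ.real A ≤ μ.real B := fun hAB => measureReal_mono hAB
  refine ⟨?_, ?_, ?_⟩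
  · -- The density lies between `1 / K` and `K / 2`, so `2 < K ^ 2`.
    have hK1 : 1 ≤ K := by
      obtain ⟨h1, h2⟩ := hf_bdd 0 0 ⟨by linarith, hC.le⟩
      have h3 := h1.trans h2
      rw [div_lt_div_iff₀ hK two_pos] at h3
      nlinarith
    have h2C : 2 * C ≤ K := (H.isDensityOn 0).two_mul_le hC.le hK
    rcases le_or_gt n 3 with hn3 | hn4
    · -- For `n ≤ 3` the bound `γ_n` is at least `K`, hence at least the length of `[-C, C]`.
      have heps1 : 1 ≤ CHR.epsSeq K η n := by
        have := CHR.one_le_two_div_add hn hn3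
        rw [heps]
        linarith
      have hgamma : 2 * C ≤ CHR.gammaSeq C K η n := by
        have h1 : K * 1 ≤ K * (CHR.epsSeq K η n + 2 * η n ^ (1 / 3 : ℝ)) := by gcongr; linarith
        have h2 : 0 ≤ 4 * C * η n := by positivity
        unfold CHR.gammaSeq
        linarith
      have huniv : {ω | CHR.len C (CHR.numBins η n) (CHR.chat X Y C α η ρ t₀ pihat n ω) ≤
          ((orc (X (2 * n) ω)).2 - (orc (X (2 * n) ω)).1) + CHR.gammaSeq C K η n} =
          Set.univ := by
        refine Set.eq_univ_of_forall fun ω => ?_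
        have ht := H.isTight_predict (CHR.train X Y n ω) (CHR.calib X Y n ω) (X (2 * n) ω)
        have h1 := CHR.len_le_two_mul hC.le ht.one_le ht.le ht.le_bins
        have h2 := (horc (X (2 * n) ω)).1.1
        change CHR.len C (CHR.numBins η n) (CHR.predict C α (ρ n) (CHR.numBins η n) n (t₀ n)
          (pihat n (CHR.train X Y n ω)) (CHR.calib X Y n ω) (X (2 * n) ω)) ≤ _
        linarith
      rw [huniv, probReal_univ]
      unfold CHR.xiSeq
      linarith
    · refine le_trans ?_ ((H.le_measure_len hX hY hindep hident horc).trans (hsub ?_))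
      · unfold CHR.xiSeq
        linarith
      intro ω hω
      simp only [Set.mem_ofPred_eq] at hω ⊢
      refine hω.trans ?_
      -- One of the two terms `√(log n / n)` of `ε_n` pays for rounding errors of order `1 / n`.
      have hlog := CHR.two_div_le_sqrt_log (show 4 ≤ n by omega)
      -- Two bins have a total width of `4 C / m ≤ 8 C η`. As `2 C ≤ K`, the excess over `4 C η` is at
      -- most `2 K η`, which the terms of `ε_n` that are linear in `η_n` cover.
      have hm : 4 * C / (CHR.numBins η n : ℝ) ≤ 4 * C * η n + K * (K * η n + η n) := by
        have h1 : 4 * C * (1 / (CHR.numBins η n : ℝ)) ≤ 4 * C * (2 * η n) := by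
          gcongr
          exact H.one_div_m_le
        have h2 : 2 * C * (2 * η n) ≤ K * (2 * η n) := by gcongr
        have h3 : K * (1 * η n) ≤ K * (K * η n) := by gcongr
        rw [div_eq_mul_one_div]
        linarith
      have hcmp : K * (6 * η n ^ (1 / 3 : ℝ) + √(Real.log n / n) + 4 / n + K * η n) +
          K * (K * η n + η n) ≤ K * (CHR.epsSeq K η n + 2 * η n ^ (1 / 3 : ℝ)) := by
        rw [← mul_add]
        refine mul_le_mul_of_nonneg_left ?_ hK.le
        have h4n : 4 / (n : ℝ) = 2 / n + 2 / n := by ring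
        rw [heps]
        linarith
      unfold CHR.gammaSeq
      linarith
  · refine le_trans ?_ ((H.le_measure_condExp_sigmaTest hX hY hindep hident).trans (hsub ?_))
    · unfold CHR.zetaSeq
      linarith
    · intro ω hω
      simp only [Set.mem_ofPred_eq] at hω ⊢
      refine le_trans ?_ hω
      rw [heps]
      linarith
  · refine le_trans ?_ ((H.le_measure_condExp_sigmaData hX hY hindep hident).trans (hsub ?_))
    · unfold CHR.zetaSeq
      linarith
    · intro ω hω
      simp only [Set.mem_ofPred_eq] at hω ⊢
      refine le_trans ?_ hω
      rw [heps]
      linarith
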